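/- **Theorem (Osipov's inequality).** Let $n\in\mathbb N$ and let $X_1,\dots,X_n$ be independent (not necessarily identically distributed) real random variables with $\mathbb E X_k=0$, $\sigma_k^2:=\mathbb E X_k^2<\infty$ and $B_n^2:=\sum_{k=1}^n\sigma_k^2>0$, $B_n>0$. Put $S_n:=\sum_{k=1}^n X_k$, let $\Phi$ be the standard normal distribution function, and set $$\Delta_n:=\sup_{x\in\mathbb R}|\mathbb P(S_n<xB_n)-\Phi(x)|,$$ $$L_n(\varepsilon):=\frac1{B_n^2}\sum_{k=1}^n\mathbb E X_k^2\mathbf 1(|X_k|>\varepsilon B_n),\qquad M_n(\varepsilon):=\frac1{B_n^3}\sum_{k=1}^n\mathbb E|X_k|^3\mathbf 1(|X_k|\le\varepsilon B_n).$$ Let $C_0$ be any absolute constant in the classical Berry–Esseen inequality, that is, any real number such that $\Delta_n\le \frac{C_0}{B_n^3}\sum_{k=1}^n\mathbb E|X_k|^3$ for all $n$ and all $X_1,\dots,X_n$ as above with finite third absolute moments. Such constants exist; in particular one may take $$C_0=\frac{2}{\sqrt{2\pi}}\inf\left\{\frac{b}{(1-2d/3)^{3/2}}+\frac{2b(b+1)}{\pi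 d(b-1)}:\ b>1,\ 0<d<\tfrac32\right\}.$$ Then, for all $n$ and all $X_1,\dots,X_n$ as above (with finite variances only), $$\Delta_n\le C\,(L_n(1)+M_n(1)),$$ and moreover $$\Delta_n\le C\max\{L_n(1),M_n(1)\},$$ where $$C=\inf_{0<b<1}\max\left\{\frac{2}{1-b^2},\ 1+\frac{4.25\,C_0}{b^3}+\frac1{\sqrt{2\pi}\,b}\left(1+\frac{2e^{-1/2}}{1+b}\right)\right\}.$$ -/

import Mathlib

open MeasureTheory ProbabilityTheory

universe u

namespace Osipov

noncomputable section

/-- The distribution function of the standard normal law. -/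
def stdNormalCDF (x : ℝ) : ℝ := cdf (gaussianReal 0 1) x

variable {Ω : Type u} [MeasurableSpace Ω] {n : ℕ}

/-- `B_n`, the nonnegative square root of the sum of the second moments of the summands. -/
def B (P : Measure Ω) (X : Fin n → Ω → ℝ) : ℝ :=
  Real.sqrt (∑ k, ∫ ω, X k ω ^ 2 ∂P)

/-- `Δ_n = sup_x |P(S_n < x B_n) - Φ(x)|`, where `S_n` is the sum of the summands. -/
def Delta (P : Measure Ω) (X : Fin n → Ω → ℝ) : ℝ :=
  ⨆ x : ℝ, |P.real {ω | ∑ k, X k ω < x * B P X} - stdNormalCDF x|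

/-- The Lindeberg fraction `L_n(ε)`. -/
def L (P : Measure Ω) (X : Fin n → Ω → ℝ) (ε : ℝ) : ℝ :=
  1 / B P X ^ 2 * ∑ k, ∫ ω in {ω | ε * B P X < |X k ω|}, X k ω ^ 2 ∂P

/-- The truncated third-moment fraction `M_n(ε)`. -/
def M (P : Measure Ω) (X : Fin n → Ω → ℝ) (ε : ℝ) : ℝ :=
  1 / B P X ^ 3 * ∑ k, ∫ ω in {ω | |X k ω| ≤ ε * B P X}, |X k ω| ^ 3 ∂P

/-- The Lyapunov fraction of order three. -/
def lyapunov (P : Measure Ω) (X : Fin n → Ω → ℝ) : ℝ :=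
  1 / B P X ^ 3 * ∑ k, ∫ ω, |X k ω| ^ 3 ∂P

/-- The standing assumptions: `X_1, …, X_n` are independent random variables with zero means and
finite variances, not all of which vanish. -/
structure Standing (P : Measure Ω) (X : Fin n → Ω → ℝ) : Prop where
  measurable : ∀ k, Measurable (X k)
  indep : iIndepFun X P
  sq_integrable : ∀ k, Integrable (fun ω => X k ω ^ 2) P
  mean_zero : ∀ k, ∫ ω, X k ω ∂P = 0
  variance_pos : 0 < ∑ k, ∫ ω, X k ω ^ 2 ∂P

/-- `C₀` is an admissible absolute constant in the classical Berry–Esseen inequality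
(third moments, not necessarily identically distributed summands). -/
def IsBerryEsseenConstant (C₀ : ℝ) : Prop :=
  ∀ (n : ℕ) (Ω : Type u) [MeasurableSpace Ω] (P : Measure Ω) [IsProbabilityMeasure P]
    (X : Fin n → Ω → ℝ), Standing P X → (∀ k, Integrable (fun ω => |X k ω| ^ 3) P) →
    Delta P X ≤ C₀ * lyapunov P X

/-- An explicit value for the constant in the Berry–Esseen inequality. -/
def berryEsseenValue : ℝ :=
  2 / Real.sqrt (2 * Real.pi) *
    sInf {y : ℝ | ∃ b d : ℝ, 1 < b ∧ 0 < d ∧ d < 3 / 2 ∧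
      y = b / (1 - 2 * d / 3) ^ (3 / 2 : ℝ) + 2 * b * (b + 1) / (Real.pi * d * (b - 1))}

/-- The constant `C` of the Osipov inequality, as a function of the Berry–Esseen constant. -/
def osipovConstant (C₀ : ℝ) : ℝ :=
  sInf {y : ℝ | ∃ b : ℝ, 0 < b ∧ b < 1 ∧
    y = max (2 / (1 - b ^ 2))
      (1 + 4.25 * C₀ / b ^ 3 +
        1 / (Real.sqrt (2 * Real.pi) * b) * (1 + 2 * Real.exp (-1 / 2) / (1 + b)))}

end

end Osipov

/-! Osipov's inequality follows from the third-moment Berry–Esseen inequality by truncation. Replace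
X_k by 0 where |X_k| > B_n and recentre, obtaining bounded independent Z_k. Fix 0 < b < 1. If L_n(1)
≥ (1 - b²)/2, the claim is trivial, since Δ_n ≤ 1. Otherwise truncation and recentring remove at
most 2 L_n(1) B_n² of variance, so the variance of ∑ Z_k lies between b² B_n² and B_n². Berry–Esseen
for the Z_k then costs at most 2.5 C₀ M_n(1) / b³. Three further errors are multiples of L_n(1): the
probability that truncation changes some X_k (Chebyshev), the shift by the means of the truncated
variables (Φ is Lipschitz), and the change of normalisation (Φ(xr) against Φ(x)). This is
`Delta_le_of_L_lt`; the infimum over b is taken afterwards, and the sum form follows from the max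
form.

That the explicit value of C₀ is admissible is shown by Stein's method rather than by Fourier
smoothing: Berry–Esseen is proved with the constant 7.5, and `berryEsseenValue` is checked to be at
least 7.5. For the bounded solution f of f'(w) - w f(w) = 1_{w < z} - Φ(z), the error P(W < z) -
Φ(z) equals E[f'(W) - W f(W)]. This splits over the summands (`stein_discrepancy_le`). Since f'
jumps at z, each term needs a bound for the probability that the sum of the other summands lies in a
short interval; `concentration` supplies it. -/

namespace Osipov

/-! ### The standard normal law and the ratio Φ/φ -/

/-- The density of the standard normal law. -/
noncomputable def stdNormalPDF (x : ℝ) : ℝ := (Real.sqrt (2 * Real.pi))⁻¹ * Real.exp (-x ^ 2 / 2)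

lemma sqrt_two_pi_pos : 0 < Real.sqrt (2 * Real.pi) := by positivity

lemma stdNormalPDF_pos (x : ℝ) : 0 < stdNormalPDF x := by
  unfold stdNormalPDF; positivity

lemma stdNormalPDF_neg (x : ℝ) : stdNormalPDF (-x) = stdNormalPDF x := by
  simp [stdNormalPDF]

lemma stdNormalPDF_eq : stdNormalPDF = gaussianPDFReal 0 1 := by
  ext x; simp [stdNormalPDF, gaussianPDFReal]

lemma hasDerivAt_stdNormalPDF (x : ℝ) : HasDerivAt stdNormalPDF (-x * stdNormalPDF x) x := by
  have h : HasDerivAt (fun x : ℝ => -x ^ 2 / 2) (-x) x := by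
    have := ((hasDerivAt_pow 2 x).neg).div_const 2
    exact this.congr_deriv (by norm_num; ring)
  have h2 := (h.exp).const_mul (Real.sqrt (2 * Real.pi))⁻¹
  exact h2.congr_deriv (by unfold stdNormalPDF; ring)

lemma continuous_stdNormalPDF : Continuous stdNormalPDF := by
  unfold stdNormalPDF; fun_prop

lemma integrable_stdNormalPDF : Integrable stdNormalPDF := by
  rw [stdNormalPDF_eq]; exact integrable_gaussianPDFReal 0 1

lemma stdNormalCDF_eq_integral (x : ℝ) : stdNormalCDF x = ∫ t in Set.Iic x, stdNormalPDF t := by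
  rw [stdNormalCDF, cdf_eq_real, Measure.real, gaussianReal_apply_eq_integral 0 one_ne_zero,
    stdNormalPDF_eq, ENNReal.toReal_ofReal]
  exact setIntegral_nonneg measurableSet_Iic fun t _ => gaussianPDFReal_nonneg 0 1 t

lemma hasDerivAt_stdNormalCDF (x : ℝ) : HasDerivAt stdNormalCDF (stdNormalPDF x) x := by
  have h : stdNormalCDF = fun u => (∫ t in (0 : ℝ)..u, stdNormalPDF t) + stdNormalCDF 0 := by
    ext u
    rw [← intervalIntegral.integral_Iic_sub_Iic integrable_stdNormalPDF.integrableOn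
      integrable_stdNormalPDF.integrableOn, stdNormalCDF_eq_integral, stdNormalCDF_eq_integral]
    ring
  rw [h]
  exact (intervalIntegral.integral_hasDerivAt_right
    (continuous_stdNormalPDF.intervalIntegrable _ _)
    (continuous_stdNormalPDF.stronglyMeasurableAtFilter _ _)
    continuous_stdNormalPDF.continuousAt).add_const _

lemma stdNormalCDF_nonneg (x : ℝ) : 0 ≤ stdNormalCDF x := cdf_nonneg _ _

lemma stdNormalCDF_le_one (x : ℝ) : stdNormalCDF x ≤ 1 := cdf_le_one _ _

lemma stdNormalCDF_neg (x : ℝ) : stdNormalCDF (-x) = 1 - stdNormalCDF x := by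
  have h : ∀ x, HasDerivAt (fun x => stdNormalCDF (-x) + stdNormalCDF x) 0 x := by
    intro x
    have h1 := ((hasDerivAt_stdNormalCDF (-x)).comp x (hasDerivAt_neg x)).add
      (hasDerivAt_stdNormalCDF x)
    exact h1.congr_deriv (by rw [stdNormalPDF_neg]; ring)
  have hc : ∀ y, stdNormalCDF (-y) + stdNormalCDF y = stdNormalCDF (-0) + stdNormalCDF 0 :=
    fun y => is_const_of_deriv_eq_zero (fun x => (h x).differentiableAt) (fun x => (h x).deriv) y 0
  have h1 : Filter.Tendsto (fun y => stdNormalCDF (-y) + stdNormalCDF y) Filter.atTop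
      (nhds (0 + 1)) :=
    ((tendsto_cdf_atBot (gaussianReal 0 1)).comp Filter.tendsto_neg_atTop_atBot).add
      (tendsto_cdf_atTop (gaussianReal 0 1))
  simp_rw [hc] at h1
  have h2 := tendsto_nhds_unique h1 tendsto_const_nhds
  have h3 := hc x
  linarith

lemma stdNormalCDF_zero : stdNormalCDF 0 = 1 / 2 := by
  have := stdNormalCDF_neg 0
  simp at this; linarith

lemma stdNormalPDF_le (x : ℝ) : stdNormalPDF x ≤ (Real.sqrt (2 * Real.pi))⁻¹ := by
  unfold stdNormalPDF
  have : Real.exp (-x ^ 2 / 2) ≤ 1 := Real.exp_le_one_iff.2 (by nlinarith [sq_nonneg x])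
  have h := inv_pos.2 sqrt_two_pi_pos
  nlinarith

/-- Mills' inequality for the lower tail. -/
lemma neg_stdNormalPDF_le (x : ℝ) : -stdNormalPDF x ≤ x * stdNormalCDF x := by
  have hlim : Filter.Tendsto stdNormalPDF Filter.atBot (nhds 0) := by
    have h : Filter.Tendsto (fun x : ℝ => -x ^ 2 / 2) Filter.atBot Filter.atBot := by
      have h1 : Filter.Tendsto (fun x : ℝ => x ^ 2) Filter.atBot Filter.atTop :=
        by
        simpa [Function.comp_def] using
          (Filter.tendsto_pow_atTop two_ne_zero).comp (Filter.tendsto_abs_atBot_atTop (G := ℝ))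
      have := (Filter.tendsto_neg_atTop_atBot.comp h1).atBot_div_const (r := (2 : ℝ)) two_pos
      exact this
    have := (Real.tendsto_exp_atBot.comp h).const_mul (Real.sqrt (2 * Real.pi))⁻¹
    rw [mul_zero] at this
    exact this
  have hint : Integrable fun t => -t * stdNormalPDF t := by
    have := (integrable_mul_exp_neg_mul_sq (b := 1 / 2) (by norm_num)).const_mul
      (-(Real.sqrt (2 * Real.pi))⁻¹)
    refine this.congr (Filter.Eventually.of_forall fun t => ?_)
    simp only [stdNormalPDF]
    rw [show -(1 / 2) * t ^ 2 = -t ^ 2 / 2 by ring]; ring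
  -- As φ'(t) = -t φ(t), the integral of t φ(t) up to x is -φ(x); on that half-line t ≤ x.
  have h := integral_Iic_of_hasDerivAt_of_tendsto' (a := x)
    (fun t _ => hasDerivAt_stdNormalPDF t) hint.integrableOn hlim
  rw [stdNormalCDF_eq_integral, ← integral_const_mul]
  have h2 : -stdNormalPDF x = ∫ t in Set.Iic x, t * stdNormalPDF t := by
    rw [sub_zero] at h
    rw [← h, ← integral_neg]; simp
  rw [h2]
  refine setIntegral_mono_on ?_ (integrable_stdNormalPDF.const_mul x).integrableOn
    measurableSet_Iic fun t ht => ?_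
  · simpa using hint.neg.integrableOn (s := Set.Iic x)
  · exact mul_le_mul_of_nonneg_right ht (stdNormalPDF_pos t).le

/-- The ratio of the distribution function to the density of the standard normal law. -/
noncomputable def cdfRatio (x : ℝ) : ℝ := stdNormalCDF x / stdNormalPDF x

lemma cdfRatio_nonneg (x : ℝ) : 0 ≤ cdfRatio x :=
  div_nonneg (stdNormalCDF_nonneg x) (stdNormalPDF_pos x).le

lemma one_add_mul_cdfRatio_nonneg (x : ℝ) : 0 ≤ 1 + x * cdfRatio x := by
  have h := neg_stdNormalPDF_le x
  have hp := stdNormalPDF_pos x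
  have : 1 + x * cdfRatio x = (stdNormalPDF x + x * stdNormalCDF x) / stdNormalPDF x := by
    unfold cdfRatio; field_simp
  rw [this]
  exact div_nonneg (by linarith) hp.le

lemma hasDerivAt_cdfRatio (x : ℝ) : HasDerivAt cdfRatio (1 + x * cdfRatio x) x := by
  have hp := (stdNormalPDF_pos x).ne'
  have := (hasDerivAt_stdNormalCDF x).div (hasDerivAt_stdNormalPDF x) hp
  exact this.congr_deriv (by unfold cdfRatio; field_simp; ring)

lemma monotone_cdfRatio : Monotone cdfRatio :=
  monotone_of_deriv_nonneg (fun x => (hasDerivAt_cdfRatio x).differentiableAt) fun x => by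
    rw [(hasDerivAt_cdfRatio x).deriv]; exact one_add_mul_cdfRatio_nonneg x

lemma continuous_cdfRatio : Continuous cdfRatio :=
  continuous_iff_continuousAt.2 fun x => (hasDerivAt_cdfRatio x).continuousAt

lemma cdfRatio_zero : cdfRatio 0 = Real.sqrt (2 * Real.pi) / 2 := by
  rw [cdfRatio, stdNormalCDF_zero, stdNormalPDF]
  simp only [ne_eq, OfNat.ofNat_ne_zero, not_false_eq_true, zero_pow, neg_zero, zero_div,
    Real.exp_zero, mul_one, div_inv_eq_mul]
  ring

lemma cdfRatio_mul_stdNormalCDF_neg (z : ℝ) :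
    cdfRatio z * stdNormalCDF (-z) = cdfRatio (-z) * stdNormalCDF z := by
  unfold cdfRatio; rw [stdNormalPDF_neg]; ring

/-- The left side is f'(w) to the left of the kink. For w ≥ 0 monotonicity moves w up to z, where
reflection turns Φ(z)/φ(z) into the ratio at -z, and Mills' inequality there bounds z times it by 1.
-/
lemma stdNormalCDF_neg_mul_le_one {w z : ℝ} (h : w ≤ z) :
    stdNormalCDF (-z) * (1 + w * cdfRatio w) ≤ 1 := by
  have h0 := stdNormalCDF_nonneg (-z)
  have h1 := stdNormalCDF_le_one (-z)
  rcases le_total w 0 with hw | hw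
  · nlinarith [one_add_mul_cdfRatio_nonneg w, cdfRatio_nonneg w,
      mul_nonneg (neg_nonneg.2 hw) (cdfRatio_nonneg w)]
  · have h2 : w * cdfRatio w ≤ z * cdfRatio z :=
      mul_le_mul h (monotone_cdfRatio h) (cdfRatio_nonneg w) (hw.trans h)
    have h3 := cdfRatio_mul_stdNormalCDF_neg z
    have h4 := one_add_mul_cdfRatio_nonneg (-z)
    have h5 := stdNormalCDF_neg z
    have h6 := stdNormalCDF_nonneg z
    calc stdNormalCDF (-z) * (1 + w * cdfRatio w)
        ≤ stdNormalCDF (-z) * (1 + z * cdfRatio z) := by gcongr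
      _ = stdNormalCDF (-z) + z * (cdfRatio z * stdNormalCDF (-z)) := by ring
      _ = stdNormalCDF (-z) + (z * cdfRatio (-z)) * stdNormalCDF z := by rw [h3]; ring
      _ ≤ stdNormalCDF (-z) + 1 * stdNormalCDF z := by gcongr; linarith
      _ = 1 := by rw [h5]; ring

lemma cdfRatio_mul_le {w z : ℝ} (h : w ≤ z) :
    cdfRatio w * stdNormalCDF (-z) ≤ Real.sqrt (2 * Real.pi) / 2 := by
  rw [← cdfRatio_zero]
  have h0 := stdNormalCDF_nonneg (-z)
  have h1 := stdNormalCDF_le_one (-z)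
  rcases le_total w 0 with hw | hw
  · nlinarith [monotone_cdfRatio hw, cdfRatio_nonneg w]
  · calc cdfRatio w * stdNormalCDF (-z) ≤ cdfRatio z * stdNormalCDF (-z) := by
          gcongr; exact monotone_cdfRatio h
      _ = cdfRatio (-z) * stdNormalCDF z := cdfRatio_mul_stdNormalCDF_neg z
      _ ≤ cdfRatio (-z) * 1 := by
          gcongr
          · exact cdfRatio_nonneg _
          · exact stdNormalCDF_le_one z
      _ ≤ cdfRatio 0 := by
          rw [mul_one]; exact monotone_cdfRatio (by linarith)

/-! ### Stein's equation: bounds on the solution and its increments -/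

/-- The bounded solution `f` of Stein's equation `f' w - w * f w = 1_{w < z} - Φ z`. -/
noncomputable def steinSol (z w : ℝ) : ℝ :=
  if w ≤ z then cdfRatio w * stdNormalCDF (-z) else cdfRatio (-w) * stdNormalCDF z

/-- The derivative of `steinSol`, away from the kink at `z`. -/
noncomputable def steinDeriv (z w : ℝ) : ℝ :=
  w * steinSol z w + (if w < z then 1 else 0) - stdNormalCDF z

lemma steinSol_of_ge {z w : ℝ} (h : z ≤ w) : steinSol z w = cdfRatio (-w) * stdNormalCDF z := by
  unfold steinSol
  split_ifs with h1
  · obtain rfl := le_antisymm h h1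
    exact cdfRatio_mul_stdNormalCDF_neg _
  · rfl

lemma continuous_steinSol (z : ℝ) : Continuous (steinSol z) := by
  refine Continuous.if_le (continuous_cdfRatio.mul continuous_const)
    ((continuous_cdfRatio.comp continuous_neg).mul continuous_const) continuous_id
    continuous_const ?_
  rintro w rfl
  exact cdfRatio_mul_stdNormalCDF_neg _

lemma steinSol_nonneg (z w : ℝ) : 0 ≤ steinSol z w := by
  unfold steinSol
  split_ifs <;> exact mul_nonneg (cdfRatio_nonneg _) (stdNormalCDF_nonneg _)

lemma steinSol_le (z w : ℝ) : steinSol z w ≤ Real.sqrt (2 * Real.pi) / 2 := by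
  rcases le_total w z with h | h
  · rw [steinSol, if_pos h]; exact cdfRatio_mul_le h
  · rw [steinSol_of_ge h]
    simpa using cdfRatio_mul_le (neg_le_neg h)

lemma abs_steinSol_le (z w : ℝ) : |steinSol z w| ≤ Real.sqrt (2 * Real.pi) / 2 := by
  rw [abs_of_nonneg (steinSol_nonneg z w)]; exact steinSol_le z w

/-- The reflection (z, w) ↦ (-z, -w) carries the right branch to the left one up to sign, so one
estimate serves both. -/
lemma abs_steinDeriv_le (z w : ℝ) : |steinDeriv z w| ≤ 1 := by
  rcases lt_or_ge w z with h | h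
  · have : steinDeriv z w = stdNormalCDF (-z) * (1 + w * cdfRatio w) := by
      rw [steinDeriv, if_pos h, steinSol, if_pos h.le, stdNormalCDF_neg]; ring
    rw [this, abs_of_nonneg (mul_nonneg (stdNormalCDF_nonneg _) (one_add_mul_cdfRatio_nonneg _))]
    exact stdNormalCDF_neg_mul_le_one h.le
  · have : steinDeriv z w = -(stdNormalCDF (- -z) * (1 + -w * cdfRatio (-w))) := by
      rw [steinDeriv, if_neg h.not_gt, steinSol_of_ge h, neg_neg]; ring
    rw [this, abs_neg,
      abs_of_nonneg (mul_nonneg (stdNormalCDF_nonneg _) (one_add_mul_cdfRatio_nonneg _))]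
    exact stdNormalCDF_neg_mul_le_one (neg_le_neg h)

lemma hasDerivAt_steinSol {z w : ℝ} (h : w ≠ z) : HasDerivAt (steinSol z) (steinDeriv z w) w := by
  rcases lt_or_gt_of_ne h with h | h
  · have h1 := (hasDerivAt_cdfRatio w).mul_const (stdNormalCDF (-z))
    refine (h1.congr_of_eventuallyEq ?_).congr_deriv ?_
    · filter_upwards [Iio_mem_nhds h] with v hv
      rw [steinSol, if_pos (le_of_lt hv)]
    · rw [steinDeriv, if_pos h, steinSol, if_pos h.le, stdNormalCDF_neg]; ring
  · have h1 := ((hasDerivAt_cdfRatio (-w)).comp w (hasDerivAt_neg w)).mul_const (stdNormalCDF z)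
    refine (h1.congr_of_eventuallyEq ?_).congr_deriv ?_
    · filter_upwards [Ioi_mem_nhds h] with v hv
      rw [steinSol_of_ge (le_of_lt hv)]; rfl
    · rw [steinDeriv, if_neg (not_lt.2 h.le), steinSol_of_ge h.le]; ring

lemma measurable_steinDeriv (z : ℝ) : Measurable (steinDeriv z) := by
  unfold steinDeriv
  exact ((measurable_id.mul (continuous_steinSol z).measurable).add
    (Measurable.ite measurableSet_Iio measurable_const measurable_const)).sub_const _

lemma intervalIntegrable_steinDeriv_comp (z w a b : ℝ) :
    IntervalIntegrable (fun t => steinDeriv z (w + t)) volume a b := by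
  refine (intervalIntegrable_const (c := (1 : ℝ))).mono_fun
    ((measurable_steinDeriv z).comp (measurable_const_add w)).aestronglyMeasurable
    (Filter.Eventually.of_forall fun t => ?_)
  simpa using abs_steinDeriv_le z (w + t)

lemma integral_steinDeriv (z w y : ℝ) :
    ∫ t in (0 : ℝ)..y, steinDeriv z (w + t) = steinSol z (w + y) - steinSol z w := by
  have := integral_eq_of_hasDerivAt_off_countable (a := 0) (b := y)
    (fun t => steinSol z (w + t)) (fun t => steinDeriv z (w + t))
    (Set.countable_singleton (z - w))
    ((continuous_steinSol z).comp (continuous_const_add w)).continuousOn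
    (fun t ht => ?_) (intervalIntegrable_steinDeriv_comp z w 0 y)
  · simpa using this
  · have hne : w + t ≠ z := fun h => ht.2 (by rw [Set.mem_singleton_iff]; linarith)
    exact (hasDerivAt_steinSol hne).comp_const_add w t

lemma abs_steinSol_sub_le (z u v : ℝ) : |steinSol z u - steinSol z v| ≤ |u - v| := by
  have h := integral_steinDeriv z v (u - v)
  rw [add_sub_cancel] at h
  rw [← h]
  have := intervalIntegral.norm_integral_le_of_norm_le_const (a := 0) (b := u - v) (C := 1)
    (f := fun t => steinDeriv z (v + t)) fun t _ => abs_steinDeriv_le z (v + t)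
  simpa using this

lemma abs_mul_steinSol_sub_le (z w s t : ℝ) :
    |(w + s) * steinSol z (w + s) - (w + t) * steinSol z (w + t)| ≤
      (|w| + Real.sqrt (2 * Real.pi) / 2) * (|s| + |t|) := by
  have h1 := abs_steinSol_sub_le z (w + s) (w + t)
  rw [show w + s - (w + t) = s - t by ring] at h1
  have h2 := abs_steinSol_le z (w + s)
  have h3 := abs_steinSol_le z (w + t)
  have h4 := abs_sub s t
  have e : (w + s) * steinSol z (w + s) - (w + t) * steinSol z (w + t) =
      w * (steinSol z (w + s) - steinSol z (w + t)) +
        (s * steinSol z (w + s) - t * steinSol z (w + t)) := by ring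
  rw [e]
  calc _ ≤ |w * (steinSol z (w + s) - steinSol z (w + t))| +
        (|s * steinSol z (w + s)| + |t * steinSol z (w + t)|) :=
        (abs_add_le _ _).trans (by gcongr; exact abs_sub _ _)
    _ ≤ |w| * (|s| + |t|) + (|s| * (Real.sqrt (2 * Real.pi) / 2) +
        |t| * (Real.sqrt (2 * Real.pi) / 2)) := by
        rw [abs_mul, abs_mul, abs_mul]
        gcongr
        linarith
    _ = _ := by ring

lemma abs_integral_abs (y : ℝ) : |∫ t in (0 : ℝ)..y, abs t| = y ^ 2 / 2 := by
  have key : ∀ y : ℝ, 0 ≤ y → ∫ t in (0 : ℝ)..y, |t| = y ^ 2 / 2 := by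
    intro y hy
    rw [intervalIntegral.integral_congr (g := fun t => t)]
    · simp
    · intro t ht
      rw [Set.uIcc_of_le hy] at ht
      exact abs_of_nonneg ht.1
  rcases le_total 0 y with hy | hy
  · rw [key y hy, abs_of_nonneg (by positivity)]
  · have h := key (-y) (by linarith)
    have h2 := intervalIntegral.integral_comp_neg (a := 0) (b := -y) (fun t : ℝ => |t|)
    simp only [abs_neg, neg_neg, neg_zero] at h2
    rw [h2] at h
    rw [intervalIntegral.integral_symm, h, abs_neg, abs_of_nonneg (by positivity)]
    ring

/-- A first-order expansion of `steinSol` with explicit remainder. -/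
lemma abs_steinSol_taylor_le (z w x y : ℝ) :
    |steinSol z (w + y) - steinSol z w - y * steinDeriv z (w + x)| ≤
      (|w| + Real.sqrt (2 * Real.pi) / 2) * (y ^ 2 / 2 + |x| * |y|) +
      |y| * (if z - max x (max 0 y) ≤ w ∧ w ≤ z - min x (min 0 y) then 1 else 0) := by
  set c := |w| + Real.sqrt (2 * Real.pi) / 2 with hc
  have hc0 : 0 ≤ c := by positivity
  set I : ℝ := if z - max x (max 0 y) ≤ w ∧ w ≤ z - min x (min 0 y) then 1 else 0 with hI
  have hI0 : 0 ≤ I := by rw [hI]; split_ifs <;> norm_num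
  -- Stein's equation splits the integrand into an increment of u f(u), which is Lipschitz up to the
  -- factor |w| + √(2π)/2, and a difference of indicators. The latter is nonzero only if z separates
  -- w + t from w + x, which confines w to the window defining `I`.
  have e : steinSol z (w + y) - steinSol z w - y * steinDeriv z (w + x) =
      ∫ t in (0 : ℝ)..y, (steinDeriv z (w + t) - steinDeriv z (w + x)) := by
    rw [intervalIntegral.integral_sub (intervalIntegrable_steinDeriv_comp z w 0 y)
      intervalIntegrable_const, integral_steinDeriv]
    simp
  have hint : IntervalIntegrable (fun t : ℝ => c * |t| + (c * |x| + I)) volume 0 y := by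
    apply Continuous.intervalIntegrable; fun_prop
  have hb : ∀ t ∈ Set.uIoc 0 y,
      |steinDeriv z (w + t) - steinDeriv z (w + x)| ≤ c * |t| + (c * |x| + I) := by
    intro t ht
    have h1 := abs_mul_steinSol_sub_le z w t x
    have h2 : |(if w + t < z then (1 : ℝ) else 0) - (if w + x < z then 1 else 0)| ≤ I := by
      have ht1 : min 0 y ≤ t := ht.1.le
      have ht2 : t ≤ max 0 y := ht.2
      have m1 := min_le_left x (min 0 y)
      have m2 := min_le_right x (min 0 y)
      have m3 := le_max_left x (max 0 y)
      have m4 := le_max_right x (max 0 y)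
      by_cases a : w + t < z <;> by_cases b : w + x < z
      · simp [a, b, hI0]
      · have : I = 1 := if_pos ⟨by linarith, by linarith⟩
        simp [a, b, this]
      · have : I = 1 := if_pos ⟨by linarith, by linarith⟩
        simp [a, b, this]
      · simp [a, b, hI0]
    have e2 : steinDeriv z (w + t) - steinDeriv z (w + x) =
        ((w + t) * steinSol z (w + t) - (w + x) * steinSol z (w + x)) +
        ((if w + t < z then (1 : ℝ) else 0) - (if w + x < z then 1 else 0)) := by
      unfold steinDeriv; ring
    rw [e2]
    refine (abs_add_le _ _).trans ?_
    rw [← hc] at h1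
    linarith
  rw [e]
  have h3 : |∫ t in (0 : ℝ)..y, (steinDeriv z (w + t) - steinDeriv z (w + x))| ≤
      |∫ t in (0 : ℝ)..y, (c * |t| + (c * |x| + I))| := by
    have := intervalIntegral.norm_integral_le_abs_of_norm_le (a := 0) (b := y) (μ := volume)
      (f := fun t => steinDeriv z (w + t) - steinDeriv z (w + x))
      (g := fun t => c * |t| + (c * |x| + I)) ?_ hint
    · simpa using this
    · exact (ae_restrict_mem measurableSet_uIoc).mono fun t ht => hb t ht
  refine h3.trans ?_
  rw [intervalIntegral.integral_add
    (by apply Continuous.intervalIntegrable; fun_prop) intervalIntegrable_const,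
    intervalIntegral.integral_const_mul, intervalIntegral.integral_const]
  refine (abs_add_le _ _).trans ?_
  rw [abs_mul, abs_integral_abs, abs_of_nonneg hc0, smul_eq_mul, abs_mul, sub_zero,
    abs_of_nonneg (a := c * |x| + I) (by positivity)]
  apply le_of_eq; ring

/-! ### Concentration of sums of independent variables -/

section Concentration

variable {Ω : Type*} [MeasurableSpace Ω] {P : Measure Ω} [IsProbabilityMeasure P]

lemma sq_integral_abs_le {Y : Ω → ℝ} (hY : MemLp Y 2 P) :
    (∫ ω, |Y ω| ∂P) ^ 2 ≤ ∫ ω, Y ω ^ 2 ∂P := by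
  have h := variance_nonneg (fun ω => |Y ω|) P
  have h2 := variance_eq_sub (X := fun ω => |Y ω|) hY.abs
  rw [h2] at h
  simpa using h

lemma integral_abs_le_of_integral_sq_le {Y : Ω → ℝ} (hY : MemLp Y 2 P) {t : ℝ} (ht : 0 ≤ t)
    (h : ∫ ω, Y ω ^ 2 ∂P ≤ t ^ 2) : ∫ ω, |Y ω| ∂P ≤ t :=
  abs_le_of_sq_le_sq' ((sq_integral_abs_le hY).trans h) ht |>.2

/-- The clamp is the identity, up to a shift, on [a, b] with a margin δ on each side. From w in [a,
b] a step of length |x| therefore changes it by at least min(δ, |x|). Elsewhere monotonicity gives a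
nonnegative product. -/
lemma clamp_increment_ge {a b δ : ℝ} (hδ : 0 ≤ δ) (w x : ℝ) :
    (if a ≤ w ∧ w ≤ b then |x| * min δ |x| else 0) ≤
      x * (max (-((b - a) / 2 + δ)) (min ((b - a) / 2 + δ) (w - (a + b) / 2)) -
        max (-((b - a) / 2 + δ)) (min ((b - a) / 2 + δ) (w - x - (a + b) / 2))) := by
  set r := (b - a) / 2 + δ with hr
  split_ifs with h
  · obtain ⟨h1, h2⟩ := h
    have e : max (-r) (min r (w - (a + b) / 2)) = w - (a + b) / 2 := by
      rw [min_eq_right (by linarith), max_eq_right (by linarith)]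
    rw [e]
    rcases le_total 0 x with hx | hx
    · rw [abs_of_nonneg hx]
      refine mul_le_mul_of_nonneg_left ?_ hx
      have : max (-r) (min r (w - x - (a + b) / 2)) ≤ w - (a + b) / 2 - min δ x := by
        refine max_le ?_ ((min_le_right _ _).trans ?_)
        · linarith [min_le_left δ x]
        · linarith [min_le_right δ x]
      linarith
    · rw [abs_of_nonpos hx, neg_mul, ← mul_neg]
      refine mul_le_mul_of_nonpos_left ?_ hx
      have : w - (a + b) / 2 + min δ (-x) ≤ max (-r) (min r (w - x - (a + b) / 2)) := by
        refine le_max_of_le_right (le_min ?_ ?_)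
        · linarith [min_le_left δ (-x)]
        · linarith [min_le_right δ (-x)]
      linarith
  · have hmono : Monotone fun v : ℝ => max (-r) (min r (v - (a + b) / 2)) := by
      intro u v huv
      exact max_le_max le_rfl (min_le_min le_rfl (by linarith))
    rcases le_total 0 x with hx | hx
    · exact mul_nonneg hx (sub_nonneg.2 (hmono (by linarith)))
    · exact mul_nonneg_of_nonpos_of_nonpos hx (sub_nonpos.2 (hmono (by linarith)))

variable {ι : Type*} {X : ι → Ω → ℝ}

lemma integral_sq_sum_le (hi : iIndepFun X P) (h2 : ∀ i, MemLp (X i) 2 P)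
    (h0 : ∀ i, ∫ ω, X i ω ∂P = 0) (s : Finset ι) :
    ∫ ω, (∑ i ∈ s, X i ω) ^ 2 ∂P = ∑ i ∈ s, ∫ ω, X i ω ^ 2 ∂P := by
  have h := IndepFun.variance_sum (s := s) (fun i _ => h2 i)
    (fun i _ j _ hij => hi.indepFun hij)
  have hz : ∫ ω, (∑ i ∈ s, X i) ω ∂P = 0 := by
    simp only [Finset.sum_apply]
    rw [integral_finsetSum _ fun i _ => (h2 i).integrable one_le_two]
    exact Finset.sum_eq_zero fun i _ => h0 i
  rw [variance_of_integral_eq_zero (memLp_finsetSum' s fun i _ => h2 i).aemeasurable hz] at h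
  simp only [Finset.sum_apply] at h
  rw [h]
  exact Finset.sum_congr rfl fun i _ =>
    variance_of_integral_eq_zero (h2 i).aemeasurable (h0 i)

omit [IsProbabilityMeasure P] in
lemma indepFun_sum_of_notMem (hm : ∀ i, Measurable (X i)) (hi : iIndepFun X P) {s : Finset ι}
    {i : ι} (his : i ∉ s) : IndepFun (fun ω => ∑ j ∈ s, X j ω) (X i) P := by
  have := hi.indepFun_finsetSum_of_notMem hm his
  convert this using 1
  ext ω; simp

/-- A concentration inequality for sums of independent centred random variables. -/
lemma concentration [DecidableEq ι] (hm : ∀ i, Measurable (X i)) (hi : iIndepFun X P)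
    (h2 : ∀ i, MemLp (X i) 2 P) (h0 : ∀ i, ∫ ω, X i ω ∂P = 0) (s : Finset ι)
    (hv : ∑ i ∈ s, ∫ ω, X i ω ^ 2 ∂P ≤ 1) {a b δ : ℝ} (hab : a ≤ b) (hδ : 0 ≤ δ) :
    (∑ i ∈ s, ∫ ω, |X i ω| * min δ |X i ω| ∂P) *
      P.real {ω | a ≤ ∑ i ∈ s, X i ω ∧ ∑ i ∈ s, X i ω ≤ b} ≤ (b - a) / 2 + 2 * δ := by
  set r := (b - a) / 2 + δ with hr
  have hr0 : 0 ≤ r := by rw [hr]; linarith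
  set cl : ℝ → ℝ := fun v => max (-r) (min r (v - (a + b) / 2)) with hcl
  have hclc : Continuous cl := by rw [hcl]; fun_prop
  have hclb : ∀ v, |cl v| ≤ r := fun v =>
    abs_le.2 ⟨le_max_left _ _, max_le (by linarith) (min_le_left _ _)⟩
  set W : Ω → ℝ := fun ω => ∑ i ∈ s, X i ω with hW
  have hWm : Measurable W := Finset.measurable_sum s fun i _ => hm i
  have hW2 : MemLp W 2 P := memLp_finsetSum s fun i _ => h2 i
  have hi1 : ∀ i, Integrable (X i) P := fun i => (h2 i).integrable one_le_two
  have hintc : ∀ (Y : Ω → ℝ) (i : ι), Measurable Y →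
      Integrable (fun ω => X i ω * cl (Y ω)) P := fun Y i hY =>
    (hi1 i).mul_bdd (c := r) (hclc.measurable.comp hY).aestronglyMeasurable
      (Filter.Eventually.of_forall fun ω => hclb _)
  -- Removing X_i makes the clamp independent of the centred X_i, so E[W cl(W)] is a sum of
  -- increments of the kind bounded in `clamp_increment_ge`.
  have hzero : ∀ i ∈ s, ∫ ω, X i ω * cl (W ω - X i ω) ∂P = 0 := by
    intro i his
    have e : ∀ ω, W ω - X i ω = ∑ j ∈ s.erase i, X j ω := fun ω => by
      simp only [hW]
      rw [← Finset.add_sum_erase s _ his]; ring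
    simp only [e]
    have hind := (indepFun_sum_of_notMem hm hi (Finset.notMem_erase i s)).symm.comp
      measurable_id hclc.measurable
    have := hind.integral_mul_eq_mul_integral (hm i).aestronglyMeasurable
      (hclc.measurable.comp (Finset.measurable_sum _ fun j _ => hm j)).aestronglyMeasurable
    simp only [Pi.mul_apply, Function.comp_apply, id] at this
    rw [this, h0 i, zero_mul]
  set A : Set Ω := {ω | a ≤ W ω ∧ W ω ≤ b} with hA
  have hAm : MeasurableSet A :=
    (measurableSet_le measurable_const hWm).inter (measurableSet_le hWm measurable_const)
  set ξ : ι → Ω → ℝ := fun i ω => |X i ω| * min δ |X i ω| with hξ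
  have hφ : Measurable fun x : ℝ => |x| * min δ |x| := by fun_prop
  have hξ2 : ∀ i, MemLp (ξ i) 2 P := by
    intro i
    refine ((h2 i).const_mul δ).of_le (hφ.comp (hm i)).aestronglyMeasurable
      (Filter.Eventually.of_forall fun ω => ?_)
    rw [Real.norm_eq_abs, Real.norm_eq_abs, abs_mul, abs_mul, abs_abs,
      abs_of_nonneg (le_min hδ (abs_nonneg _)), abs_of_nonneg hδ, mul_comm]
    gcongr
    exact min_le_left _ _
  have hξ1 : ∀ i, Integrable (ξ i) P := fun i => (hξ2 i).integrable one_le_two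
  set m := ∑ i ∈ s, ∫ ω, ξ i ω ∂P with hmdef
  have hlow : ∫ ω in A, ∑ i ∈ s, ξ i ω ∂P ≤ r := by
    calc ∫ ω in A, ∑ i ∈ s, ξ i ω ∂P
        = ∫ ω, A.indicator (fun ω => ∑ i ∈ s, ξ i ω) ω ∂P := (integral_indicator hAm).symm
      _ ≤ ∫ ω, ∑ i ∈ s, (X i ω * cl (W ω) - X i ω * cl (W ω - X i ω)) ∂P := by
          refine integral_mono ((integrable_finsetSum s fun i _ => hξ1 i).indicator hAm)
            (integrable_finsetSum s fun i _ => (hintc W i hWm).sub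
              (hintc (fun ω => W ω - X i ω) i (hWm.sub (hm i)))) fun ω => ?_
          have h := Finset.sum_le_sum fun i (_ : i ∈ s) =>
            clamp_increment_ge (a := a) (b := b) hδ (W ω) (X i ω)
          simp only [mul_sub] at h
          refine le_trans (le_of_eq ?_) h
          by_cases hω : a ≤ W ω ∧ W ω ≤ b
          · rw [Set.indicator_of_mem (show ω ∈ A from hω)]
            simp only [if_pos hω, hξ]
          · rw [Set.indicator_of_notMem (show ω ∉ A from hω)]
            simp only [if_neg hω, Finset.sum_const_zero]
      _ = ∑ i ∈ s, ∫ ω, X i ω * cl (W ω) ∂P := by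
          have e := integral_finsetSum (μ := P) s
            (f := fun i ω => X i ω * cl (W ω) - X i ω * cl (W ω - X i ω))
            fun i _ => (hintc W i hWm).sub (hintc (fun ω => W ω - X i ω) i (hWm.sub (hm i)))
          rw [e]
          refine Finset.sum_congr rfl fun i his => ?_
          rw [integral_sub (hintc W i hWm) (hintc (fun ω => W ω - X i ω) i (hWm.sub (hm i))),
            hzero i his, sub_zero]
      _ = ∫ ω, W ω * cl (W ω) ∂P := by
          rw [← integral_finsetSum _ fun i _ => hintc W i hWm]
          simp only [hW, Finset.sum_mul]
      _ ≤ ∫ ω, |W ω| * r ∂P := by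
          refine integral_mono ?_ ((hW2.integrable one_le_two).abs.mul_const r) fun ω => ?_
          · exact (hW2.integrable one_le_two).mul_bdd (c := r)
              (hclc.measurable.comp hWm).aestronglyMeasurable
              (Filter.Eventually.of_forall fun ω => hclb _)
          · refine (le_abs_self _).trans ?_
            rw [abs_mul]
            exact mul_le_mul_of_nonneg_left (hclb _) (abs_nonneg _)
      _ ≤ 1 * r := by
          rw [integral_mul_const]
          refine mul_le_mul_of_nonneg_right ?_ hr0
          refine integral_abs_le_of_integral_sq_le hW2 zero_le_one ?_
          rw [hW, integral_sq_sum_le hi h2 h0, one_pow]; exact hv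
      _ = r := one_mul r
  have hη2 : MemLp (fun ω => ∑ i ∈ s, ξ i ω) 2 P := memLp_finsetSum s fun i _ => hξ2 i
  -- Since ξ_i ≤ δ|X_i|, the variance of ∑ ξ_i is at most δ². Hence the random sum under E[1_A ·]
  -- may be replaced by its mean m at the cost δ.
  have hdev : ∫ ω, |m - ∑ i ∈ s, ξ i ω| ∂P ≤ δ := by
    refine integral_abs_le_of_integral_sq_le ((memLp_const m).sub hη2) hδ ?_
    have hmean : ∫ ω, (∑ i ∈ s, ξ i) ω ∂P = m := by
      simp only [Finset.sum_apply]
      rw [integral_finsetSum _ fun i _ => hξ1 i]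
    have hvar := variance_eq_integral (X := ∑ i ∈ s, ξ i) (μ := P)
      (memLp_finsetSum' s fun i _ => hξ2 i).aemeasurable
    rw [hmean] at hvar
    have e : ∫ ω, (m - ∑ i ∈ s, ξ i ω) ^ 2 ∂P = Var[∑ i ∈ s, ξ i; P] := by
      rw [hvar]
      refine integral_congr_ae (Filter.Eventually.of_forall fun ω => ?_)
      simp only [Finset.sum_apply]; ring
    change ∫ ω, (m - ∑ i ∈ s, ξ i ω) ^ 2 ∂P ≤ δ ^ 2
    rw [e, IndepFun.variance_sum (fun i _ => hξ2 i) fun i _ j _ hij =>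
      (hi.indepFun hij).comp hφ hφ]
    calc ∑ i ∈ s, Var[ξ i; P] ≤ ∑ i ∈ s, ∫ ω, δ ^ 2 * X i ω ^ 2 ∂P := by
          refine Finset.sum_le_sum fun i _ => ?_
          refine (variance_le_expectation_sq (hξ2 i).aestronglyMeasurable).trans ?_
          refine integral_mono (hξ2 i).integrable_sq ((h2 i).integrable_sq.const_mul _) fun ω => ?_
          simp only [Pi.pow_apply, hξ, mul_pow, sq_abs]
          rw [mul_comm]
          gcongr
          exact min_le_left _ _
      _ = δ ^ 2 * ∑ i ∈ s, ∫ ω, X i ω ^ 2 ∂P := by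
          rw [Finset.mul_sum]
          exact Finset.sum_congr rfl fun i _ => integral_const_mul _ _
      _ ≤ δ ^ 2 := by nlinarith [sq_nonneg δ]
  have hη1 : Integrable (fun ω => ∑ i ∈ s, ξ i ω) P := hη2.integrable one_le_two
  have hcomp : m * P.real A - ∫ ω in A, ∑ i ∈ s, ξ i ω ∂P ≤ δ := by
    have e : ∫ ω in A, (m - ∑ i ∈ s, ξ i ω) ∂P =
        m * P.real A - ∫ ω in A, ∑ i ∈ s, ξ i ω ∂P := by
      rw [integral_sub (integrable_const m) hη1.integrableOn, setIntegral_const, smul_eq_mul,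
        mul_comm]
    rw [← e]
    calc ∫ ω in A, (m - ∑ i ∈ s, ξ i ω) ∂P ≤ ∫ ω in A, |m - ∑ i ∈ s, ξ i ω| ∂P :=
          integral_mono ((integrable_const m).sub hη1).integrableOn
            ((integrable_const m).sub hη1).abs.integrableOn fun ω => le_abs_self _
      _ ≤ ∫ ω, |m - ∑ i ∈ s, ξ i ω| ∂P :=
          setIntegral_le_integral ((integrable_const m).sub hη1).abs
            (Filter.Eventually.of_forall fun ω => abs_nonneg _)
      _ ≤ δ := hdev
  change m * P.real A ≤ _
  linarith

end Concentration

/-! ### The Stein discrepancy of one summand -/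

section BerryEsseen

variable {Ω : Type*} [MeasurableSpace Ω] {P : Measure Ω} [IsProbabilityMeasure P]

/-- Fubini for the product law of (V, Y). The outer variable ω' acts as an independent copy of Y
without enlarging the probability space. -/
lemma integral_indepFun_eq {V Y : Ω → ℝ} (hV : Measurable V) (hY : Measurable Y)
    (h : IndepFun V Y P) {F : ℝ × ℝ → ℝ} (hF : Measurable F)
    (hint : Integrable (fun ω => F (V ω, Y ω)) P) :
    ∫ ω, F (V ω, Y ω) ∂P = ∫ ω', ∫ ω, F (V ω, Y ω') ∂P ∂P := by
  have hmap := (indepFun_iff_map_prod_eq_prod_map_map hV.aemeasurable hY.aemeasurable).1 h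
  have hVY : Measurable fun ω => (V ω, Y ω) := hV.prodMk hY
  have := Measure.isProbabilityMeasure_map (μ := P) hV.aemeasurable
  have := Measure.isProbabilityMeasure_map (μ := P) hY.aemeasurable
  have hint2 : Integrable F ((P.map V).prod (P.map Y)) := by
    rw [← hmap]
    exact (integrable_map_measure hF.aestronglyMeasurable hVY.aemeasurable).2 hint
  rw [← integral_map (φ := fun ω => (V ω, Y ω)) hVY.aemeasurable hF.aestronglyMeasurable, hmap,
    integral_prod_symm F hint2,
    integral_map hY.aemeasurable
      (hF.stronglyMeasurable.integral_prod_left' (μ := P.map V)).aestronglyMeasurable]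
  refine integral_congr_ae (Filter.Eventually.of_forall fun ω' => ?_)
  exact integral_map hV.aemeasurable
    (hF.comp (measurable_id.prodMk measurable_const)).aestronglyMeasurable

omit [IsProbabilityMeasure P] in
lemma memLp_three_of_integrable {Y : Ω → ℝ} (hm : Measurable Y)
    (h : Integrable (fun ω => |Y ω| ^ 3) P) : MemLp Y 3 P := by
  have := (integrable_norm_rpow_iff (p := 3) (μ := P) hm.aestronglyMeasurable (by norm_num)
    (by norm_num)).1
  refine this ?_
  refine h.congr (Filter.Eventually.of_forall fun ω => ?_)
  simp only [Real.norm_eq_abs]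
  rw [← Real.rpow_natCast]
  norm_num

lemma memLp_two_of_integrable {Y : Ω → ℝ} (hm : Measurable Y)
    (h : Integrable (fun ω => |Y ω| ^ 3) P) : MemLp Y 2 P :=
  (memLp_three_of_integrable hm h).mono_exponent (by norm_num)

lemma sq_mul_le_cubes {s t : ℝ} (hs : 0 ≤ s) (ht : 0 ≤ t) :
    s ^ 2 * t ≤ (2 * s ^ 3 + t ^ 3) / 3 := by
  nlinarith [mul_nonneg (add_nonneg hs (add_nonneg hs ht)) (sq_nonneg (s - t))]

/-- Integrate s² t ≤ (2s³ + t³)/3 with s and t two independent copies of |Y|. -/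
lemma integral_sq_mul_integral_abs_le {Y : Ω → ℝ} (hm : Measurable Y)
    (h : Integrable (fun ω => |Y ω| ^ 3) P) :
    (∫ ω, Y ω ^ 2 ∂P) * ∫ ω, |Y ω| ∂P ≤ ∫ ω, |Y ω| ^ 3 ∂P := by
  have h2 := memLp_two_of_integrable hm h
  have hpt : ∀ x : ℝ, (∫ ω, Y ω ^ 2 ∂P) * |x| ≤ (2 * (∫ ω, |Y ω| ^ 3 ∂P) + |x| ^ 3) / 3 := by
    intro x
    have : ∫ ω, Y ω ^ 2 * |x| ∂P ≤ ∫ ω, (2 * |Y ω| ^ 3 + |x| ^ 3) / 3 ∂P := by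
      refine integral_mono (h2.integrable_sq.mul_const _)
        (((h.const_mul 2).add (integrable_const _)).div_const 3) fun ω => ?_
      have := sq_mul_le_cubes (abs_nonneg (Y ω)) (abs_nonneg x)
      rwa [sq_abs] at this
    rw [integral_mul_const, integral_div, integral_add (h.const_mul 2) (integrable_const _),
      integral_const_mul] at this
    simpa using this
  have h1 : Integrable Y P := h2.integrable one_le_two
  have : ∫ ω', (∫ ω, Y ω ^ 2 ∂P) * |Y ω'| ∂P ≤
      ∫ ω', (2 * (∫ ω, |Y ω| ^ 3 ∂P) + |Y ω'| ^ 3) / 3 ∂P :=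
    integral_mono (h1.abs.const_mul _) (((integrable_const _).add h).div_const 3)
      fun ω' => hpt (Y ω')
  rw [integral_const_mul, integral_div, integral_add (integrable_const _) h] at this
  simp only [integral_const, probReal_univ, smul_eq_mul, one_mul] at this
  linarith

lemma max_sub_min_le (x y : ℝ) : max x (max 0 y) - min x (min 0 y) ≤ |x| + |y| := by
  rcases abs_cases x with ⟨h1, _⟩ | ⟨h1, _⟩ <;> rcases abs_cases y with ⟨h2, _⟩ | ⟨h2, _⟩ <;>
  rw [h1, h2] <;> rcases max_cases 0 y with ⟨h3, _⟩ | ⟨h3, _⟩ <;>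
  rcases min_cases 0 y with ⟨h4, _⟩ | ⟨h4, _⟩ <;>
  rcases max_cases x (max 0 y) with ⟨h5, _⟩ | ⟨h5, _⟩ <;>
  rcases min_cases x (min 0 y) with ⟨h6, _⟩ | ⟨h6, _⟩ <;> linarith

/-- The contribution of one summand `Y` to the Stein discrepancy. -/
lemma stein_discrepancy_le {V Y : Ω → ℝ} (hV : Measurable V) (hY : Measurable Y)
    (hind : IndepFun V Y P) (hV2 : MemLp V 2 P) (hV1 : ∫ ω, V ω ^ 2 ∂P ≤ 1)
    (hY3 : Integrable (fun ω => |Y ω| ^ 3) P) (hY0 : ∫ ω, Y ω ∂P = 0) {k₁ k₂ : ℝ} (hk₁ : 0 ≤ k₁)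
    (hconc : ∀ a b, a ≤ b → P.real {ω | a ≤ V ω ∧ V ω ≤ b} ≤ k₁ * (b - a) + k₂) (z : ℝ) :
    |∫ ω, Y ω * steinSol z (V ω + Y ω) ∂P -
        (∫ ω, Y ω ^ 2 ∂P) * ∫ ω, steinDeriv z (V ω + Y ω) ∂P| ≤
      ((1 + Real.sqrt (2 * Real.pi) / 2) * (3 / 2) + 2 * k₁) * (∫ ω, |Y ω| ^ 3 ∂P) +
        k₂ * ∫ ω, Y ω ^ 2 ∂P := by
  set c := Real.sqrt (2 * Real.pi) / 2 with hc
  have hc0 : 0 ≤ c := by positivity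
  have hY2 := memLp_two_of_integrable hY hY3
  have hYi : Integrable Y P := hY2.integrable one_le_two
  have hVi : Integrable V P := hV2.integrable one_le_two
  have hVa : ∫ ω, |V ω| ∂P ≤ 1 :=
    integral_abs_le_of_integral_sq_le hV2 zero_le_one (by simpa using hV1)
  have hfm : Measurable (steinSol z) := (continuous_steinSol z).measurable
  have hf : ∀ U : Ω → ℝ, Measurable U → Integrable (fun ω => steinSol z (U ω)) P := fun U hU =>
    Integrable.of_bound (hfm.comp hU).aestronglyMeasurable c
      (Filter.Eventually.of_forall fun ω => abs_steinSol_le z _)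
  have hg : ∀ U : Ω → ℝ, Measurable U → Integrable (fun ω => steinDeriv z (U ω)) P := fun U hU =>
    Integrable.of_bound ((measurable_steinDeriv z).comp hU).aestronglyMeasurable 1
      (Filter.Eventually.of_forall fun ω => abs_steinDeriv_le z _)
  set β := ∫ ω, |Y ω| ^ 3 ∂P with hβ
  set σ := ∫ ω, Y ω ^ 2 ∂P with hσ
  set ν := ∫ ω, |Y ω| ∂P with hν
  have hνσ : σ * ν ≤ β := integral_sq_mul_integral_abs_le hY hY3
  set G := ∫ ω, steinDeriv z (V ω + Y ω) ∂P with hG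
  set E : ℝ → ℝ := fun y => ∫ ω, steinSol z (V ω + y) ∂P with hE
  have hEm : Measurable E := by
    have : StronglyMeasurable fun p : Ω × ℝ => steinSol z (V p.1 + p.2) :=
      (hfm.comp ((hV.comp measurable_fst).add measurable_snd)).stronglyMeasurable
    exact (this.integral_prod_left' (μ := P)).measurable
  have hEb : ∀ y, |E y| ≤ c := by
    intro y
    have := norm_integral_le_of_norm_le_const (μ := P) (f := fun ω => steinSol z (V ω + y))
      (C := c) (Filter.Eventually.of_forall fun ω => abs_steinSol_le z _)
    simpa using this
  have h1 : ∫ ω, Y ω * steinSol z (V ω + Y ω) ∂P = ∫ ω', Y ω' * E (Y ω') ∂P := by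
    have := integral_indepFun_eq hV hY hind (F := fun p => p.2 * steinSol z (p.1 + p.2))
      (measurable_snd.mul (hfm.comp (measurable_fst.add measurable_snd)))
      (hYi.mul_bdd (c := c) (hfm.comp (hV.add hY)).aestronglyMeasurable
        (Filter.Eventually.of_forall fun ω => abs_steinSol_le z _))
    rw [this]
    refine integral_congr_ae (Filter.Eventually.of_forall fun ω' => ?_)
    exact integral_const_mul _ _
  have hYE : Integrable (fun ω' => Y ω' * E (Y ω')) P :=
    hYi.mul_bdd (c := c) (hEm.comp hY).aestronglyMeasurable
      (Filter.Eventually.of_forall fun ω => hEb _)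
  -- With Y' an independent copy of Y, the discrepancy is E[Y'(f(V + Y') - f(V) - Y' f'(V + Y))].
  -- The subtracted term in f(V) is free because Y' is centred, and the bracket is the remainder in
  -- `abs_steinSol_taylor_le`.
  have h2 : ∫ ω, Y ω * steinSol z (V ω + Y ω) ∂P - σ * G =
      ∫ ω', (Y ω' * E (Y ω') - Y ω' * E 0 - Y ω' ^ 2 * G) ∂P := by
    have hi : Integrable (fun ω' => Y ω' * E (Y ω') - Y ω' * E 0) P := hYE.sub (hYi.mul_const _)
    rw [integral_sub hi (hY2.integrable_sq.mul_const _), integral_sub hYE (hYi.mul_const _),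
      integral_mul_const, integral_mul_const, hY0, h1]
    ring
  -- The window is random through Y, but Y is independent of V: freeze Y = x, use concentration on a
  -- window of length at most |x| + |y|, then average over x.
  have hprob : ∀ y, ∫ ω, (if z - max (Y ω) (max 0 y) ≤ V ω ∧ V ω ≤ z - min (Y ω) (min 0 y)
      then (1 : ℝ) else 0) ∂P ≤ k₁ * (ν + |y|) + k₂ := by
    intro y
    have hset : MeasurableSet {p : ℝ × ℝ | z - max p.2 (max 0 y) ≤ p.1 ∧
        p.1 ≤ z - min p.2 (min 0 y)} :=
      (measurableSet_le (by fun_prop) measurable_fst).inter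
        (measurableSet_le measurable_fst (by fun_prop))
    have hFm : Measurable fun p : ℝ × ℝ => if z - max p.2 (max 0 y) ≤ p.1 ∧
        p.1 ≤ z - min p.2 (min 0 y) then (1 : ℝ) else 0 :=
      Measurable.ite hset measurable_const measurable_const
    have hFi : Integrable (fun ω => (fun p : ℝ × ℝ => if z - max p.2 (max 0 y) ≤ p.1 ∧
        p.1 ≤ z - min p.2 (min 0 y) then (1 : ℝ) else 0) (V ω, Y ω)) P :=
      Integrable.of_bound (hFm.comp (hV.prodMk hY)).aestronglyMeasurable 1
        (Filter.Eventually.of_forall fun ω => by dsimp only; split_ifs <;> simp)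
    rw [integral_indepFun_eq hV hY hind hFm hFi]
    have hin : ∀ x : ℝ, ∫ ω, (if z - max x (max 0 y) ≤ V ω ∧ V ω ≤ z - min x (min 0 y)
        then (1 : ℝ) else 0) ∂P ≤ k₁ * (|x| + |y|) + k₂ := by
      intro x
      have hs : MeasurableSet {ω | z - max x (max 0 y) ≤ V ω ∧ V ω ≤ z - min x (min 0 y)} :=
        (measurableSet_le measurable_const hV).inter (measurableSet_le hV measurable_const)
      have e : ∫ ω, (if z - max x (max 0 y) ≤ V ω ∧ V ω ≤ z - min x (min 0 y)
          then (1 : ℝ) else 0) ∂P =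
          P.real {ω | z - max x (max 0 y) ≤ V ω ∧ V ω ≤ z - min x (min 0 y)} := by
        rw [← integral_indicator_one hs]
        refine integral_congr_ae (Filter.Eventually.of_forall fun ω => ?_)
        simp only [Set.indicator_apply, Set.mem_ofPred_eq, Pi.one_apply]
      rw [e]
      have hab : z - max x (max 0 y) ≤ z - min x (min 0 y) := by
        linarith [min_le_left x (min 0 y), le_max_left x (max 0 y)]
      refine (hconc _ _ hab).trans ?_
      have := mul_le_mul_of_nonneg_left (max_sub_min_le x y) hk₁
      linarith
    calc _ ≤ ∫ ω', (k₁ * (|Y ω'| + |y|) + k₂) ∂P := by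
          refine integral_mono_of_nonneg (Filter.Eventually.of_forall fun ω' => ?_)
            (((hYi.abs.add (integrable_const _)).const_mul _).add (integrable_const _))
            (Filter.Eventually.of_forall fun ω' => hin (Y ω'))
          exact integral_nonneg fun ω => by dsimp only; split_ifs <;> simp
      _ = k₁ * (ν + |y|) + k₂ := by
          have hi : Integrable (fun ω' => k₁ * (|Y ω'| + |y|)) P :=
            (hYi.abs.add (integrable_const _)).const_mul _
          rw [integral_add hi (integrable_const _), integral_const_mul,
            integral_add hYi.abs (integrable_const _)]
          simp [hν]
  have hD : ∀ y, |y * E y - y * E 0 - y ^ 2 * G| ≤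
      (1 + c) * (|y| ^ 3 / 2 + ν * y ^ 2) + y ^ 2 * (k₁ * (ν + |y|) + k₂) := by
    intro y
    have e : y * E y - y * E 0 - y ^ 2 * G =
        y * ∫ ω, (steinSol z (V ω + y) - steinSol z (V ω) - y * steinDeriv z (V ω + Y ω)) ∂P := by
      have hi : Integrable (fun ω => steinSol z (V ω + y) - steinSol z (V ω)) P :=
        (hf _ (hV.add_const y)).sub (hf _ hV)
      have hi' : Integrable (fun ω => y * steinDeriv z (V ω + Y ω)) P :=
        (hg _ (hV.add hY)).const_mul y
      rw [integral_sub hi hi',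
        integral_sub (hf _ (hV.add_const y)) (hf _ hV), integral_const_mul]
      simp only [hE, add_zero, hG]; ring
    have hVY : Integrable (fun ω => |V ω| * |Y ω|) P :=
      (hind.comp measurable_norm measurable_norm).integrable_mul hVi.norm hYi.norm
    have hVYe : ∫ ω, |V ω| * |Y ω| ∂P = (∫ ω, |V ω| ∂P) * ν :=
      (hind.comp measurable_norm measurable_norm).integral_mul_eq_mul_integral
        hVi.norm.aestronglyMeasurable hYi.norm.aestronglyMeasurable
    have ha : Integrable (fun ω => |V ω| * (y ^ 2 / 2) + |y| * (|V ω| * |Y ω|)) P :=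
      (hVi.abs.mul_const _).add (hVY.const_mul _)
    have hb : Integrable (fun ω => c * (y ^ 2 / 2) + c * |y| * |Y ω|) P :=
      (integrable_const _).add (hYi.abs.const_mul _)
    have hi0 : Integrable (fun ω => |V ω| * (y ^ 2 / 2) + |y| * (|V ω| * |Y ω|) +
        (c * (y ^ 2 / 2) + c * |y| * |Y ω|)) P := ha.add hb
    have hi1 : Integrable (fun ω => (|V ω| + c) * (y ^ 2 / 2 + |Y ω| * |y|)) P :=
      hi0.congr (Filter.Eventually.of_forall fun ω => by dsimp only; ring)
    have hmain : ∫ ω, (|V ω| + c) * (y ^ 2 / 2 + |Y ω| * |y|) ∂P =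
        ((∫ ω, |V ω| ∂P) + c) * (y ^ 2 / 2 + ν * |y|) := by
      have : ∫ ω, (|V ω| + c) * (y ^ 2 / 2 + |Y ω| * |y|) ∂P =
          ∫ ω, (|V ω| * (y ^ 2 / 2) + |y| * (|V ω| * |Y ω|) +
            (c * (y ^ 2 / 2) + c * |y| * |Y ω|)) ∂P :=
        integral_congr_ae (Filter.Eventually.of_forall fun ω => by dsimp only; ring)
      rw [this, integral_add ha hb,
        integral_add (hVi.abs.mul_const _) (hVY.const_mul _),
        integral_add (integrable_const _) (hYi.abs.const_mul _), integral_mul_const,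
        integral_const_mul, integral_const_mul (c * |y|), hVYe]
      simp only [integral_const, probReal_univ, smul_eq_mul, one_mul]
      ring
    have hind' : Integrable (fun ω => |y| * (if z - max (Y ω) (max 0 y) ≤ V ω ∧
        V ω ≤ z - min (Y ω) (min 0 y) then (1 : ℝ) else 0)) P := by
      refine (Integrable.of_bound (Measurable.ite ?_ measurable_const
        measurable_const).aestronglyMeasurable 1
        (Filter.Eventually.of_forall fun ω => by split_ifs <;> simp)).const_mul _
      exact (measurableSet_le (by fun_prop) hV).inter (measurableSet_le hV (by fun_prop))
    have hb := norm_integral_le_of_norm_le (μ := P)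
      (f := fun ω => steinSol z (V ω + y) - steinSol z (V ω) - y * steinDeriv z (V ω + Y ω))
      (hi1.add hind')
      (Filter.Eventually.of_forall fun ω => abs_steinSol_taylor_le z (V ω) (Y ω) y)
    have hb2 := integral_add hi1 hind'
    simp only [Pi.add_apply] at hb
    rw [hb2, hmain, integral_const_mul, Real.norm_eq_abs] at hb
    have hp := mul_le_mul_of_nonneg_left (hprob y) (abs_nonneg y)
    have hν0 : 0 ≤ ν := integral_nonneg fun ω => abs_nonneg _
    have hv : ((∫ ω, |V ω| ∂P) + c) * (y ^ 2 / 2 + ν * |y|) ≤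
        (1 + c) * (y ^ 2 / 2 + ν * |y|) := by gcongr
    rw [e, abs_mul]
    have := mul_le_mul_of_nonneg_left (hb.trans (add_le_add hv hp)) (abs_nonneg y)
    refine this.trans (le_of_eq ?_)
    rw [← sq_abs y]; ring
  rw [h2]
  have hQ3 : Integrable (fun ω => k₁ * (ν * Y ω ^ 2 + |Y ω| ^ 3)) P :=
    ((hY2.integrable_sq.const_mul ν).add hY3).const_mul _
  have hQ1 : Integrable (fun ω => (1 + c) * (|Y ω| ^ 3 / 2 + ν * Y ω ^ 2)) P :=
    ((hY3.div_const 2).add (hY2.integrable_sq.const_mul ν)).const_mul _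
  have hQ2 : Integrable (fun ω => k₁ * (ν * Y ω ^ 2 + |Y ω| ^ 3) + k₂ * Y ω ^ 2) P :=
    hQ3.add (hY2.integrable_sq.const_mul _)
  have hb := norm_integral_le_of_norm_le (μ := P)
    (f := fun ω' => Y ω' * E (Y ω') - Y ω' * E 0 - Y ω' ^ 2 * G) (hQ1.add hQ2)
    (Filter.Eventually.of_forall fun ω => by
      refine (hD (Y ω)).trans (le_of_eq ?_)
      simp only [Pi.add_apply]
      have : |Y ω| ^ 3 = |Y ω| * Y ω ^ 2 := by rw [← sq_abs (Y ω)]; ring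
      rw [this]; ring)
  simp only [Pi.add_apply] at hb
  rw [integral_add hQ1 hQ2, integral_const_mul,
    integral_add (hY3.div_const 2) (hY2.integrable_sq.const_mul ν), integral_div,
    integral_const_mul, integral_add hQ3 (hY2.integrable_sq.const_mul _), integral_const_mul,
    integral_add (hY2.integrable_sq.const_mul ν) hY3, integral_const_mul, integral_const_mul,
    Real.norm_eq_abs] at hb
  refine hb.trans ?_
  have t1 : (1 + c) * (β / 2 + ν * σ) ≤ (1 + c) * (β / 2 + β) := by
    gcongr; linarith
  have t2 : k₁ * (ν * σ + β) ≤ k₁ * (β + β) := by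
    gcongr; linarith
  linarith

end BerryEsseen

/-! ### Berry–Esseen with the constant 7.5 -/

section

variable {Ω : Type*} [MeasurableSpace Ω] {P : Measure Ω} [IsProbabilityMeasure P]

lemma sq_sub_cube_div_le_mul_min {δ t : ℝ} (hδ : 0 < δ) (ht : 0 ≤ t) :
    t ^ 2 - t ^ 3 / (4 * δ) ≤ t * min δ t := by
  have h0 : 0 ≤ t ^ 3 / (4 * δ) := by positivity
  rcases min_cases δ t with ⟨h, _⟩ | ⟨h, _⟩ <;> rw [h]
  · have : t * δ - (t ^ 2 - t ^ 3 / (4 * δ)) = t * (2 * δ - t) ^ 2 / (4 * δ) := by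
      field_simp; ring
    have h2 : 0 ≤ t * (2 * δ - t) ^ 2 / (4 * δ) := by positivity
    linarith
  · nlinarith

/-- The maximum of t² - t³/(2γ) over t ≥ 0 is 16γ²/27, attained at t = 4γ/3; this is the double root
in the factorisation. -/
lemma sq_le_cube_div_add {γ t : ℝ} (hγ : 0 < γ) (ht : 0 ≤ t) :
    t ^ 2 ≤ t ^ 3 / (2 * γ) + 16 / 27 * γ ^ 2 := by
  have : t ^ 3 / (2 * γ) + 16 / 27 * γ ^ 2 - t ^ 2 =
      (t - 4 / 3 * γ) ^ 2 * (t + 2 / 3 * γ) / (2 * γ) := by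
    field_simp; ring
  have h2 : 0 ≤ (t - 4 / 3 * γ) ^ 2 * (t + 2 / 3 * γ) / (2 * γ) := by positivity
  linarith

lemma sqrt_two_pi_lt : Real.sqrt (2 * Real.pi) < 2.5068 := by
  rw [Real.sqrt_lt' (by norm_num)]
  have := Real.pi_lt_d4
  norm_num at this ⊢
  linarith

variable {ι : Type*} [Fintype ι] {X : ι → Ω → ℝ}

lemma berry_esseen_normalized_of_le (hm : ∀ i, Measurable (X i))
    (hi : iIndepFun X P) (h3 : ∀ i, Integrable (fun ω => |X i ω| ^ 3) P)
    (h0 : ∀ i, ∫ ω, X i ω ∂P = 0) (hv : ∑ i, ∫ ω, X i ω ^ 2 ∂P = 1) {γ : ℝ} (hγ : 0 < γ)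
    (hγ1 : γ ≤ 1 / 7.5) (hle : ∑ i, ∫ ω, |X i ω| ^ 3 ∂P ≤ γ) (z : ℝ) :
    |P.real {ω | ∑ i, X i ω < z} - stdNormalCDF z| ≤ 7.5 * γ := by
  classical
  have h2 : ∀ i, MemLp (X i) 2 P := fun i => memLp_two_of_integrable (hm i) (h3 i)
  set V : ι → Ω → ℝ := fun i ω => ∑ j ∈ Finset.univ.erase i, X j ω with hV
  have hVm : ∀ i, Measurable (V i) := fun i => Finset.measurable_sum _ fun j _ => hm j
  set W : Ω → ℝ := fun ω => ∑ i, X i ω with hW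
  have hWm : Measurable W := Finset.measurable_sum _ fun j _ => hm j
  have hVX : ∀ i ω, V i ω + X i ω = W ω := fun i ω =>
    Finset.sum_erase_add _ _ (Finset.mem_univ i)
  have hsq0 : ∀ i, 0 ≤ ∫ ω, X i ω ^ 2 ∂P := fun i => integral_nonneg fun ω => sq_nonneg _
  have hvar : ∀ i, ∑ j ∈ Finset.univ.erase i, ∫ ω, X j ω ^ 2 ∂P = 1 - ∫ ω, X i ω ^ 2 ∂P := by
    intro i
    have := Finset.sum_erase_add Finset.univ (fun j => ∫ ω, X j ω ^ 2 ∂P) (Finset.mem_univ i)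
    linarith
  have hcube : ∀ i, ∑ j ∈ Finset.univ.erase i, ∫ ω, |X j ω| ^ 3 ∂P ≤
      γ - ∫ ω, |X i ω| ^ 3 ∂P := by
    intro i
    have := Finset.sum_erase_add Finset.univ (fun j => ∫ ω, |X j ω| ^ 3 ∂P) (Finset.mem_univ i)
    linarith
  -- With δ = γ/2 the sum is at least 1/2 - σ_i² + E|X_i|³/(2γ) ≥ 1/2 - 16γ²/27, and γ ≤ 1/7.5 makes
  -- this at least 0.489. Dividing `concentration` by 0.489 gives the constants 1.0225 and 2.045
  -- below.
  have hmom : ∀ i, 0.489 ≤ ∑ j ∈ Finset.univ.erase i,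
      ∫ ω, |X j ω| * min (γ / 2) |X j ω| ∂P := by
    intro i
    have a1 : ∀ j, (∫ ω, X j ω ^ 2 ∂P) - (∫ ω, |X j ω| ^ 3 ∂P) / (2 * γ) ≤
        ∫ ω, |X j ω| * min (γ / 2) |X j ω| ∂P := by
      intro j
      rw [← integral_div, ← integral_sub (h2 j).integrable_sq ((h3 j).div_const _)]
      refine integral_mono ((h2 j).integrable_sq.sub ((h3 j).div_const _)) ?_ fun ω => ?_
      · refine ((h2 j).integrable one_le_two).abs.mul_bdd (c := γ / 2) (by fun_prop)
          (Filter.Eventually.of_forall fun ω => ?_)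
        rw [Real.norm_eq_abs, abs_of_nonneg (le_min (by positivity) (abs_nonneg _))]
        exact min_le_left _ _
      · have := sq_sub_cube_div_le_mul_min (half_pos hγ) (abs_nonneg (X j ω))
        rwa [sq_abs, show 4 * (γ / 2) = 2 * γ by ring] at this
    have a2 := Finset.sum_le_sum fun j (_ : j ∈ Finset.univ.erase i) => a1 j
    rw [Finset.sum_sub_distrib, hvar, ← Finset.sum_div] at a2
    have a3 : (∑ j ∈ Finset.univ.erase i, ∫ ω, |X j ω| ^ 3 ∂P) / (2 * γ) ≤
        (γ - ∫ ω, |X i ω| ^ 3 ∂P) / (2 * γ) := by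
      gcongr; exact hcube i
    have a4 : (γ - ∫ ω, |X i ω| ^ 3 ∂P) / (2 * γ) = 1 / 2 - (∫ ω, |X i ω| ^ 3 ∂P) / (2 * γ) := by
      field_simp
    have a5 : ∫ ω, X i ω ^ 2 ∂P ≤ (∫ ω, |X i ω| ^ 3 ∂P) / (2 * γ) + 16 / 27 * γ ^ 2 := by
      have : ∫ ω, X i ω ^ 2 ∂P ≤ ∫ ω, (|X i ω| ^ 3 / (2 * γ) + 16 / 27 * γ ^ 2) ∂P := by
        refine integral_mono (h2 i).integrable_sq
          (((h3 i).div_const _).add (integrable_const _)) fun ω => ?_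
        have := sq_le_cube_div_add hγ (abs_nonneg (X i ω))
        rwa [sq_abs] at this
      rw [integral_add ((h3 i).div_const _) (integrable_const _), integral_div] at this
      simpa using this
    have a6 : γ ^ 2 ≤ (1 / 7.5) ^ 2 := by gcongr
    have a7 : (1 / 7.5 : ℝ) ^ 2 ≤ 0.0178 := by norm_num
    linarith
  have hconc : ∀ i a b, a ≤ b → P.real {ω | a ≤ V i ω ∧ V i ω ≤ b} ≤
      1.0225 * (b - a) + 2.045 * γ := by
    intro i a b hab
    have hc := concentration hm hi h2 h0 (Finset.univ.erase i)
      (by rw [hvar]; linarith [hsq0 i]) hab (half_pos hγ).le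
    have hp : 0 ≤ P.real {ω | a ≤ V i ω ∧ V i ω ≤ b} := measureReal_nonneg
    have h4 : 0.489 * P.real {ω | a ≤ V i ω ∧ V i ω ≤ b} ≤ (b - a) / 2 + 2 * (γ / 2) :=
      (mul_le_mul_of_nonneg_right (hmom i) hp).trans hc
    norm_num at h4 ⊢
    linarith
  have hone : ∀ i, |∫ ω, X i ω * steinSol z (W ω) ∂P -
      (∫ ω, X i ω ^ 2 ∂P) * ∫ ω, steinDeriv z (W ω) ∂P| ≤
      ((1 + Real.sqrt (2 * Real.pi) / 2) * (3 / 2) + 2 * 1.0225) * (∫ ω, |X i ω| ^ 3 ∂P) +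
        (2.045 * γ) * ∫ ω, X i ω ^ 2 ∂P := by
    intro i
    have := stein_discrepancy_le (hVm i) (hm i)
      (indepFun_sum_of_notMem hm hi (Finset.notMem_erase i Finset.univ))
      (memLp_finsetSum _ fun j _ => h2 j)
      (by rw [integral_sq_sum_le hi h2 h0, hvar]; linarith [hsq0 i]) (h3 i) (h0 i)
      (by norm_num) (hconc i) z
    simp only [hVX] at this
    exact this
  have hfi : ∀ Y : Ω → ℝ, Integrable Y P → Integrable (fun ω => Y ω * steinSol z (W ω)) P :=
    fun Y hY => hY.mul_bdd (c := Real.sqrt (2 * Real.pi) / 2)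
      ((continuous_steinSol z).measurable.comp hWm).aestronglyMeasurable
      (Filter.Eventually.of_forall fun ω => abs_steinSol_le z _)
  have hX1 : ∀ i, Integrable (X i) P := fun i => (h2 i).integrable one_le_two
  have hset : MeasurableSet {ω | W ω < z} := measurableSet_lt hWm measurable_const
  have hstein : P.real {ω | W ω < z} - stdNormalCDF z =
      -∑ i, (∫ ω, X i ω * steinSol z (W ω) ∂P -
        (∫ ω, X i ω ^ 2 ∂P) * ∫ ω, steinDeriv z (W ω) ∂P) := by
    rw [Finset.sum_sub_distrib, ← Finset.sum_mul, hv, one_mul,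
      ← integral_finsetSum _ fun i _ => hfi _ (hX1 i)]
    have e1 : ∀ ω, ∑ i, X i ω * steinSol z (W ω) = W ω * steinSol z (W ω) := fun ω =>
      (Finset.sum_mul _ _ _).symm
    have e2 : ∀ ω, steinDeriv z (W ω) =
        W ω * steinSol z (W ω) + {ω | W ω < z}.indicator 1 ω - stdNormalCDF z := by
      intro ω
      simp only [steinDeriv, Set.indicator_apply, Set.mem_ofPred_eq, Pi.one_apply]
    have hWi := hfi W (integrable_finsetSum _ fun i _ => hX1 i)
    have hind : Integrable ({ω | W ω < z}.indicator (1 : Ω → ℝ)) P :=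
      (integrable_const (1 : ℝ)).indicator hset
    have hsum : Integrable (fun ω => W ω * steinSol z (W ω) +
        {ω | W ω < z}.indicator (1 : Ω → ℝ) ω) P := hWi.add hind
    simp only [e1, e2]
    rw [integral_sub hsum (integrable_const _), integral_add hWi hind,
      integral_indicator_one hset]
    simp only [integral_const, probReal_univ, smul_eq_mul, one_mul]
    ring
  rw [hstein, abs_neg]
  calc _ ≤ ∑ i, (((1 + Real.sqrt (2 * Real.pi) / 2) * (3 / 2) + 2 * 1.0225) *
        (∫ ω, |X i ω| ^ 3 ∂P) + (2.045 * γ) * ∫ ω, X i ω ^ 2 ∂P) :=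
        (Finset.abs_sum_le_sum_abs _ _).trans (Finset.sum_le_sum fun i _ => hone i)
    _ = ((1 + Real.sqrt (2 * Real.pi) / 2) * (3 / 2) + 2 * 1.0225) *
        (∑ i, ∫ ω, |X i ω| ^ 3 ∂P) + 2.045 * γ := by
        rw [Finset.sum_add_distrib, ← Finset.mul_sum, ← Finset.mul_sum, hv, mul_one]
    _ ≤ ((1 + Real.sqrt (2 * Real.pi) / 2) * (3 / 2) + 2 * 1.0225) * γ + 2.045 * γ := by
        gcongr
    -- With √(2π) < 2.5068 the total coefficient is about 7.47.
    _ ≤ 7.5 * γ := by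
        have := sqrt_two_pi_lt
        rw [← add_mul]
        refine mul_le_mul_of_nonneg_right ?_ hγ.le
        norm_num at this ⊢
        linarith

lemma abs_prob_sub_stdNormalCDF_le_one (s : Set Ω) (z : ℝ) :
    |P.real s - stdNormalCDF z| ≤ 1 := by
  have h1 : 0 ≤ P.real s := measureReal_nonneg
  have h2 : P.real s ≤ 1 := measureReal_le_one
  have h3 := stdNormalCDF_nonneg z
  have h4 := stdNormalCDF_le_one z
  rw [abs_le]; constructor <;> linarith

/-- The Berry–Esseen inequality for sums of unit variance. -/
lemma berry_esseen_normalized (hm : ∀ i, Measurable (X i))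
    (hi : iIndepFun X P) (h3 : ∀ i, Integrable (fun ω => |X i ω| ^ 3) P)
    (h0 : ∀ i, ∫ ω, X i ω ∂P = 0) (hv : ∑ i, ∫ ω, X i ω ^ 2 ∂P = 1) (z : ℝ) :
    |P.real {ω | ∑ i, X i ω < z} - stdNormalCDF z| ≤
      7.5 * ∑ i, ∫ ω, |X i ω| ^ 3 ∂P := by
  have hβ : 0 ≤ ∑ i, ∫ ω, |X i ω| ^ 3 ∂P :=
    Finset.sum_nonneg fun i _ => integral_nonneg fun ω => by positivity
  refine le_of_forall_pos_le_add fun ε hε => ?_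
  -- The added ε makes γ visibly positive, as needed for a truncation level. For γ > 1/7.5 the bound
  -- exceeds 1 and is trivial.
  set γ := ∑ i, ∫ ω, |X i ω| ^ 3 ∂P + ε / 7.5 with hγ
  have hγ0 : 0 < γ := by positivity
  have e : 7.5 * ∑ i, ∫ ω, |X i ω| ^ 3 ∂P + ε = 7.5 * γ := by
    rw [hγ, mul_add]; congr 1; field_simp
  rw [e]
  rcases le_or_gt γ (1 / 7.5) with h | h
  · have hε' : 0 < ε / 7.5 := by positivity
    exact berry_esseen_normalized_of_le hm hi h3 h0 hv hγ0 h (by rw [hγ]; linarith) z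
  · refine (abs_prob_sub_stdNormalCDF_le_one _ z).trans ?_
    rw [div_lt_iff₀ (by norm_num)] at h
    linarith

end

lemma B_pos {Ω : Type*} [MeasurableSpace Ω] {n : ℕ} {P : Measure Ω} {X : Fin n → Ω → ℝ}
    (h : Standing P X) : 0 < B P X := Real.sqrt_pos.2 h.variance_pos

lemma B_sq {Ω : Type*} [MeasurableSpace Ω] {n : ℕ} {P : Measure Ω} {X : Fin n → Ω → ℝ}
    (h : Standing P X) : B P X ^ 2 = ∑ k, ∫ ω, X k ω ^ 2 ∂P := Real.sq_sqrt h.variance_pos.le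

lemma lyapunov_nonneg {Ω : Type*} [MeasurableSpace Ω] {n : ℕ} (P : Measure Ω)
    (X : Fin n → Ω → ℝ) : 0 ≤ lyapunov P X := by
  have hB : 0 ≤ B P X := Real.sqrt_nonneg _
  exact mul_nonneg (by positivity) (Finset.sum_nonneg fun i _ => integral_nonneg fun ω => by
    positivity)

/-- The Berry–Esseen inequality with the constant `7.5`. -/
lemma Delta_le_lyapunov {Ω : Type*} [MeasurableSpace Ω] {n : ℕ} {P : Measure Ω}
    [IsProbabilityMeasure P] {X : Fin n → Ω → ℝ} (h : Standing P X)
    (h3 : ∀ k, Integrable (fun ω => |X k ω| ^ 3) P) : Delta P X ≤ 7.5 * lyapunov P X := by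
  have hB := B_pos h
  refine ciSup_le fun x => ?_
  have hset : {ω | ∑ k, X k ω < x * B P X} = {ω | ∑ k, X k ω / B P X < x} := by
    ext ω
    simp only [Set.mem_ofPred_eq]
    rw [← Finset.sum_div, div_lt_iff₀ hB]
  have hcube : ∀ k ω, |X k ω / B P X| ^ 3 = |X k ω| ^ 3 / B P X ^ 3 := fun k ω => by
    rw [abs_div, div_pow, abs_of_pos hB]
  have key := berry_esseen_normalized (P := P) (X := fun k ω => X k ω / B P X)
    (fun k => (h.measurable k).div_const _)
    (h.indep.comp (fun _ y => y / B P X) fun _ => measurable_id.div_const _)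
    (fun k => by simp only [hcube]; exact (h3 k).div_const _)
    (fun k => by rw [integral_div, h.mean_zero k, zero_div])
    (by
      simp only [div_pow, integral_div]
      rw [← Finset.sum_div, ← B_sq h, div_self (by positivity)]) x
  simp only [hcube, integral_div] at key
  rw [← Finset.sum_div] at key
  rw [hset]
  refine key.trans (le_of_eq ?_)
  rw [lyapunov]; ring

/-! ### Comparison of 7.5 with the explicit constant -/

lemma le_mul_add_mul_of_discrim {b p c p₀ c₀ K : ℝ} (hb : 1 < b) (hc₀ : 0 < c₀)
    (hp : p₀ ≤ p) (hc : c₀ ≤ c) (hp₀ : 0 < p₀)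
    (hK : (K + p₀ - c₀) ^ 2 ≤ 4 * K * (p₀ + c₀)) :
    K ≤ b * p + c * (b * (b + 1) / (b - 1)) := by
  have hb1 : 0 < b - 1 := by linarith
  -- Multiplied by b - 1, this is a quadratic inequality in b, and `hK` says that its discriminant
  -- is not positive.
  have h1 : K ≤ b * p₀ + c₀ * (b * (b + 1) / (b - 1)) := by
    have e : b * p₀ + c₀ * (b * (b + 1) / (b - 1)) - K =
        ((p₀ + c₀) * b ^ 2 - (K + p₀ - c₀) * b + K) / (b - 1) := by
      field_simp; ring
    have h2 : 0 ≤ (p₀ + c₀) * b ^ 2 - (K + p₀ - c₀) * b + K := by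
      have h3 : 0 ≤ 4 * (p₀ + c₀) * ((p₀ + c₀) * b ^ 2 - (K + p₀ - c₀) * b + K) := by
        nlinarith [sq_nonneg (2 * (p₀ + c₀) * b - (K + p₀ - c₀))]
      exact nonneg_of_mul_nonneg_right h3 (by positivity)
    have := div_nonneg h2 hb1.le
    linarith
  have h4 : 0 ≤ b * (b + 1) / (b - 1) := by positivity
  have h5 := mul_le_mul_of_nonneg_right hc h4
  have h6 := mul_le_mul_of_nonneg_left hp (by linarith : 0 ≤ b)
  linarith

/-- The two-parameter expression in `berryEsseenValue` is bounded below by `9.41`. -/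
lemma berryEsseenValue_term_ge {b d : ℝ} (hb : 1 < b) (hd : 0 < d) (hd' : d < 3 / 2) :
    9.41 ≤ b / (1 - 2 * d / 3) ^ (3 / 2 : ℝ) + 2 * b * (b + 1) / (Real.pi * d * (b - 1)) := by
  set v := Real.sqrt (1 - 2 * d / 3) with hv
  have hpos : 0 < 1 - 2 * d / 3 := by linarith
  have hv0 : 0 < v := Real.sqrt_pos.2 hpos
  have hv2 : v ^ 2 = 1 - 2 * d / 3 := Real.sq_sqrt hpos.le
  have hd3 : d = 3 / 2 * (1 - v ^ 2) := by rw [hv2]; ring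
  have hv1 : v < 1 := by nlinarith
  have hpow : (1 - 2 * d / 3) ^ (3 / 2 : ℝ) = v ^ 3 := by
    rw [← hv2, ← Real.rpow_natCast, ← Real.rpow_mul hv0.le, ← Real.rpow_natCast]
    norm_num
  have hb1 : 0 < b - 1 := by linarith
  have e : b / (1 - 2 * d / 3) ^ (3 / 2 : ℝ) + 2 * b * (b + 1) / (Real.pi * d * (b - 1)) =
      b * (1 / v ^ 3) + 2 / (Real.pi * d) * (b * (b + 1) / (b - 1)) := by
    rw [hpow]; field_simp
  rw [e]
  have hp : ∀ v₂ p₀ : ℝ, v ≤ v₂ → 0 < p₀ → p₀ * v₂ ^ 3 ≤ 1 → p₀ ≤ 1 / v ^ 3 := by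
    intro v₂ p₀ h h0 h1
    rw [le_div_iff₀ (by positivity)]
    refine le_trans ?_ h1
    gcongr
  -- In terms of v, 2/(πd) = 4/(3π(1 - v²)), and 0.4244 is just below 4/(3π).
  have hc : ∀ v₁ c₀ : ℝ, 0 ≤ v₁ → v₁ ≤ v → 0 < c₀ → c₀ * (1 - v₁ ^ 2) ≤ 0.4244 →
      c₀ ≤ 2 / (Real.pi * d) := by
    intro v₁ c₀ h00 h h0 h1
    rw [le_div_iff₀ (by positivity), hd3]
    have h2 : v₁ ^ 2 ≤ v ^ 2 := by gcongr
    have h3 : c₀ * (1 - v ^ 2) ≤ 0.4244 :=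
      (mul_le_mul_of_nonneg_left (by linarith) h0.le).trans h1
    have h4 := mul_le_mul_of_nonneg_left h3 Real.pi_pos.le
    have h5 := Real.pi_lt_d4
    norm_num at h4 h5 ⊢
    linarith
  -- As 1/v³ decreases and 2/(πd) increases in v, each of five intervals uses the first at its right
  -- end and the second at its left end, rounded down. The optimisation over b is then the
  -- discriminant criterion.
  rcases le_total v 0.62 with h1 | h1
  · exact le_mul_add_mul_of_discrim (p₀ := 4.195) (c₀ := 0.4244) hb (by norm_num)
      (hp _ _ h1 (by norm_num) (by norm_num)) (hc 0 _ le_rfl hv0.le (by norm_num) (by norm_num))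
      (by norm_num) (by norm_num)
  rcases le_total v 0.7 with h2 | h2
  · exact le_mul_add_mul_of_discrim (p₀ := 2.915) (c₀ := 0.689) hb (by norm_num)
      (hp _ _ h2 (by norm_num) (by norm_num))
      (hc _ _ (by norm_num) h1 (by norm_num) (by norm_num)) (by norm_num) (by norm_num)
  rcases le_total v 0.754 with h3 | h3
  · exact le_mul_add_mul_of_discrim (p₀ := 2.332) (c₀ := 0.832) hb (by norm_num)
      (hp _ _ h3 (by norm_num) (by norm_num))
      (hc _ _ (by norm_num) h2 (by norm_num) (by norm_num)) (by norm_num) (by norm_num)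
  rcases le_total v 0.822 with h4 | h4
  · exact le_mul_add_mul_of_discrim (p₀ := 1.8) (c₀ := 0.983) hb (by norm_num)
      (hp _ _ h4 (by norm_num) (by norm_num))
      (hc _ _ (by norm_num) h3 (by norm_num) (by norm_num)) (by norm_num) (by norm_num)
  · exact le_mul_add_mul_of_discrim (p₀ := 1) (c₀ := 1.308) hb (by norm_num)
      (hp 1 _ hv1.le (by norm_num) (by norm_num))
      (hc _ _ (by norm_num) h4 (by norm_num) (by norm_num)) (by norm_num) (by norm_num)

/-- The bound 9.41 is chosen so that 9.41 · 2/√(2π) still exceeds 7.5. -/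
lemma seven_and_half_le_berryEsseenValue : 7.5 ≤ berryEsseenValue := by
  have h : 9.41 ≤ sInf {y : ℝ | ∃ b d : ℝ, 1 < b ∧ 0 < d ∧ d < 3 / 2 ∧
      y = b / (1 - 2 * d / 3) ^ (3 / 2 : ℝ) + 2 * b * (b + 1) / (Real.pi * d * (b - 1))} := by
    refine le_csInf ⟨_, 2, 1, by norm_num, by norm_num, by norm_num, rfl⟩ ?_
    rintro y ⟨b, d, hb, hd, hd', rfl⟩
    exact berryEsseenValue_term_ge hb hd hd'
  have h2 : (7.5 : ℝ) / 9.41 ≤ 2 / Real.sqrt (2 * Real.pi) := by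
    rw [div_le_div_iff₀ (by norm_num) sqrt_two_pi_pos]
    have := sqrt_two_pi_lt
    norm_num at this ⊢
    linarith
  calc (7.5 : ℝ) = 7.5 / 9.41 * 9.41 := by norm_num
    _ ≤ berryEsseenValue := mul_le_mul h2 h (by norm_num) (by positivity)

lemma isBerryEsseenConstant_berryEsseenValue : IsBerryEsseenConstant.{u} berryEsseenValue := by
  intro n Ω _ P _ X h h3
  exact (Delta_le_lyapunov h h3).trans
    (mul_le_mul_of_nonneg_right seven_and_half_le_berryEsseenValue (lyapunov_nonneg P X))

/-! ### Sensitivity of Φ to shifts and rescaling -/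

lemma abs_stdNormalCDF_sub_le (u v : ℝ) :
    |stdNormalCDF u - stdNormalCDF v| ≤ (Real.sqrt (2 * Real.pi))⁻¹ * |u - v| :=
  Convex.norm_image_sub_le_of_norm_hasDerivWithin_le (s := Set.univ)
    (fun x _ => (hasDerivAt_stdNormalCDF x).hasDerivWithinAt)
    (fun x _ => by
      rw [Real.norm_eq_abs, abs_of_pos (stdNormalPDF_pos x)]; exact stdNormalPDF_le x)
    convex_univ (Set.mem_univ v) (Set.mem_univ u)

lemma mul_stdNormalPDF_le (x : ℝ) :
    x * stdNormalPDF x ≤ (Real.sqrt (2 * Real.pi))⁻¹ * Real.exp (-1 / 2) := by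
  have h1 : x ≤ Real.exp ((x ^ 2 - 1) / 2) := by
    have := Real.add_one_le_exp ((x ^ 2 - 1) / 2)
    nlinarith [sq_nonneg (x - 1)]
  have h2 : Real.exp ((x ^ 2 - 1) / 2) * Real.exp (-x ^ 2 / 2) = Real.exp (-1 / 2) := by
    rw [← Real.exp_add]; congr 1; ring
  have h3 : x * Real.exp (-x ^ 2 / 2) ≤ Real.exp (-1 / 2) := by
    rw [← h2]; gcongr
  calc x * stdNormalPDF x = (Real.sqrt (2 * Real.pi))⁻¹ * (x * Real.exp (-x ^ 2 / 2)) := by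
        rw [stdNormalPDF]; ring
    _ ≤ _ := by gcongr

/-- On [x, ∞) the density is at most φ(x), so the increment is at most x φ(x)(r - 1), and x φ(x) is
largest at x = 1. -/
lemma abs_stdNormalCDF_mul_sub_le_of_nonneg {x r : ℝ} (hx : 0 ≤ x) (hr : 1 ≤ r) :
    |stdNormalCDF (x * r) - stdNormalCDF x| ≤
      (Real.sqrt (2 * Real.pi))⁻¹ * Real.exp (-1 / 2) * (r - 1) := by
  have hxr : x ≤ x * r := le_mul_of_one_le_right hx hr
  have h := Convex.norm_image_sub_le_of_norm_hasDerivWithin_le (s := Set.Ici x)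
    (f := stdNormalCDF) (C := stdNormalPDF x)
    (fun y _ => (hasDerivAt_stdNormalCDF y).hasDerivWithinAt)
    (fun y hy => by
      rw [Real.norm_eq_abs, abs_of_pos (stdNormalPDF_pos y)]
      unfold stdNormalPDF
      have : x ^ 2 ≤ y ^ 2 := pow_le_pow_left₀ hx hy 2
      gcongr)
    (convex_Ici x) (Set.self_mem_Ici) (Set.mem_Ici.2 hxr)
  rw [Real.norm_eq_abs, Real.norm_eq_abs, abs_of_nonneg (sub_nonneg.2 hxr)] at h
  refine h.trans ?_
  have := mul_le_mul_of_nonneg_right (mul_stdNormalPDF_le x) (sub_nonneg.2 hr)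
  linarith

lemma abs_stdNormalCDF_mul_sub_le (x : ℝ) {r : ℝ} (hr : 1 ≤ r) :
    |stdNormalCDF (x * r) - stdNormalCDF x| ≤
      (Real.sqrt (2 * Real.pi))⁻¹ * Real.exp (-1 / 2) * (r - 1) := by
  rcases le_total 0 x with hx | hx
  · exact abs_stdNormalCDF_mul_sub_le_of_nonneg hx hr
  · have h := abs_stdNormalCDF_mul_sub_le_of_nonneg (neg_nonneg.2 hx) hr
    rw [neg_mul, stdNormalCDF_neg, stdNormalCDF_neg] at h
    rw [abs_sub_comm]
    convert h using 2
    ring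

/-! ### Moments of truncated and recentred variables -/

lemma abs_sub_cube_le_of_nonneg {m : ℝ} (hm : 0 ≤ m) (y : ℝ) :
    |y - m| ^ 3 ≤ 2.5 * |y| ^ 3 + 3 * m ^ 2 * (m - y) := by
  rcases le_total m y with h | h
  · obtain ⟨t, rfl⟩ : ∃ t, y = m + t := ⟨y - m, by ring⟩
    have ht : 0 ≤ t := by linarith
    rw [abs_of_nonneg (by linarith), abs_of_nonneg (by linarith)]
    have : 0 ≤ m ^ 3 := by positivity
    have : 0 ≤ m ^ 2 * t := by positivity
    have : 0 ≤ m * t ^ 2 := by positivity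
    have : 0 ≤ t ^ 3 := by positivity
    nlinarith
  · rw [abs_sub_comm, abs_of_nonneg (sub_nonneg.2 h)]
    rcases le_total 0 y with hy | hy
    · have h1 : (m - y) ^ 2 ≤ m ^ 2 := by nlinarith
      have h2 := mul_le_mul_of_nonneg_right h1 (sub_nonneg.2 h)
      have h3 : 0 ≤ m ^ 2 * (m - y) := mul_nonneg (sq_nonneg m) (sub_nonneg.2 h)
      have h4 : 0 ≤ 2.5 * |y| ^ 3 := by positivity
      nlinarith
    · obtain ⟨t, rfl⟩ : ∃ t, y = -t := ⟨-y, by ring⟩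
      have ht : 0 ≤ t := by linarith
      rw [abs_neg, abs_of_nonneg ht]
      have h1 : 0 ≤ (t - 4 / 3 * m) ^ 2 * (t + 2 / 3 * m) := by positivity
      have h2 : 0 ≤ m ^ 3 := by positivity
      nlinarith

/-- The last term has zero expectation when m is the mean of y, so recentring multiplies the third
absolute moment by at most 2.5. -/
lemma abs_sub_cube_le (m y : ℝ) :
    |y - m| ^ 3 ≤ 2.5 * |y| ^ 3 + 3 * |m| * m * (m - y) := by
  rcases le_total 0 m with hm | hm
  · have := abs_sub_cube_le_of_nonneg hm y
    rw [abs_of_nonneg hm]; linarith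
  · have := abs_sub_cube_le_of_nonneg (neg_nonneg.2 hm) (-y)
    rw [abs_neg, show -y - -m = -(y - m) by ring, abs_neg] at this
    rw [abs_of_nonpos hm]; linarith

/-- Truncation at level `c`. -/
noncomputable def trunc (c x : ℝ) : ℝ := if |x| ≤ c then x else 0

lemma measurable_trunc (c : ℝ) : Measurable (trunc c) :=
  Measurable.ite (measurableSet_le measurable_norm measurable_const) measurable_id measurable_const

lemma abs_trunc_le {c : ℝ} (hc : 0 ≤ c) (x : ℝ) : |trunc c x| ≤ c := by
  unfold trunc; split_ifs with h
  · exact h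
  · simpa using hc

section Truncation

variable {Ω : Type*} [MeasurableSpace Ω] {P : Measure Ω} [IsProbabilityMeasure P]
  {X : Ω → ℝ} {c : ℝ}

lemma memLp_trunc (hX : Measurable X) (hc : 0 ≤ c) (p : ENNReal) :
    MemLp (fun ω => trunc c (X ω)) p P :=
  MemLp.of_bound ((measurable_trunc c).comp hX).aestronglyMeasurable c
    (Filter.Eventually.of_forall fun ω => abs_trunc_le hc (X ω))

omit [IsProbabilityMeasure P] in
lemma integral_sq_sub_trunc (hX : Measurable X) :
    ∫ ω, (X ω - trunc c (X ω)) ^ 2 ∂P = ∫ ω in {ω | c < |X ω|}, X ω ^ 2 ∂P := by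
  rw [← integral_indicator (show MeasurableSet {ω | c < |X ω|} from
    measurableSet_lt measurable_const hX.norm)]
  refine integral_congr_ae (Filter.Eventually.of_forall fun ω => ?_)
  by_cases h : |X ω| ≤ c
  · simp [trunc, h]
  · simp [trunc, h, not_le.1 h]

omit [IsProbabilityMeasure P] in
lemma integral_cube_trunc (hX : Measurable X) :
    ∫ ω, |trunc c (X ω)| ^ 3 ∂P = ∫ ω in {ω | |X ω| ≤ c}, |X ω| ^ 3 ∂P := by
  rw [← integral_indicator (show MeasurableSet {ω | |X ω| ≤ c} from
    measurableSet_le hX.norm measurable_const)]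
  refine integral_congr_ae (Filter.Eventually.of_forall fun ω => ?_)
  by_cases h : |X ω| ≤ c
  · simp [trunc, h]
  · simp [trunc, h]

/-- As X is centred, the truncated part and the discarded tail have opposite means, and |X| ≤ X²/c
on the tail. -/
lemma abs_integral_trunc_le (hX : Measurable X) (hX2 : MemLp X 2 P) (h0 : ∫ ω, X ω ∂P = 0)
    (hc : 0 < c) :
    |∫ ω, trunc c (X ω) ∂P| ≤ (∫ ω in {ω | c < |X ω|}, X ω ^ 2 ∂P) / c := by
  have hT := memLp_trunc (P := P) hX hc.le 2
  have hU : MemLp (fun ω => X ω - trunc c (X ω)) 2 P := hX2.sub hT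
  have e : ∫ ω, trunc c (X ω) ∂P = -∫ ω, (X ω - trunc c (X ω)) ∂P := by
    rw [integral_sub (hX2.integrable one_le_two) (hT.integrable one_le_two), h0]; ring
  rw [e, abs_neg, ← integral_sq_sub_trunc hX, ← integral_div]
  refine norm_integral_le_of_norm_le (f := fun ω => X ω - trunc c (X ω))
    (hU.integrable_sq.div_const c)
    (Filter.Eventually.of_forall fun ω => ?_)
  rw [Real.norm_eq_abs, le_div_iff₀ hc]
  by_cases h : |X ω| ≤ c
  · simp [trunc, h]
  · rw [trunc, if_neg h, sub_zero, ← sq_abs, sq]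
    exact mul_le_mul_of_nonneg_left (not_le.1 h).le (abs_nonneg _)

lemma sq_integral_trunc_le (hX : Measurable X) (hX2 : MemLp X 2 P) (h0 : ∫ ω, X ω ∂P = 0)
    (hc : 0 < c) :
    (∫ ω, trunc c (X ω) ∂P) ^ 2 ≤ ∫ ω in {ω | c < |X ω|}, X ω ^ 2 ∂P := by
  have hT := memLp_trunc (P := P) hX hc.le 2
  have hU : MemLp (fun ω => X ω - trunc c (X ω)) 2 P := hX2.sub hT
  have e : ∫ ω, trunc c (X ω) ∂P = -∫ ω, (X ω - trunc c (X ω)) ∂P := by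
    rw [integral_sub (hX2.integrable one_le_two) (hT.integrable one_le_two), h0]; ring
  rw [e, neg_sq, ← integral_sq_sub_trunc hX]
  refine le_trans ?_ (sq_integral_abs_le hU)
  rw [← sq_abs]
  exact pow_le_pow_left₀ (abs_nonneg _) abs_integral_le_integral_abs 2

lemma integral_sq_trunc (hX : Measurable X) (hX2 : MemLp X 2 P) (hc : 0 ≤ c) :
    ∫ ω, trunc c (X ω) ^ 2 ∂P =
      ∫ ω, X ω ^ 2 ∂P - ∫ ω in {ω | c < |X ω|}, X ω ^ 2 ∂P := by
  have hT := memLp_trunc (P := P) hX hc 2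
  have hU : MemLp (fun ω => X ω - trunc c (X ω)) 2 P := hX2.sub hT
  rw [← integral_sq_sub_trunc hX, ← integral_sub hX2.integrable_sq hU.integrable_sq]
  refine integral_congr_ae (Filter.Eventually.of_forall fun ω => ?_)
  by_cases h : |X ω| ≤ c <;> simp [trunc, h]

lemma integral_sq_centered_trunc (hX : Measurable X) (hc : 0 ≤ c) :
    ∫ ω, (trunc c (X ω) - ∫ ω, trunc c (X ω) ∂P) ^ 2 ∂P =
      ∫ ω, trunc c (X ω) ^ 2 ∂P - (∫ ω, trunc c (X ω) ∂P) ^ 2 := by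
  have hT := memLp_trunc (P := P) hX hc 2
  rw [← variance_eq_integral hT.aemeasurable, variance_eq_sub hT]
  rfl

lemma integral_cube_centered_trunc_le (hX : Measurable X) (hc : 0 ≤ c) :
    ∫ ω, |trunc c (X ω) - ∫ ω, trunc c (X ω) ∂P| ^ 3 ∂P ≤
      2.5 * ∫ ω in {ω | |X ω| ≤ c}, |X ω| ^ 3 ∂P := by
  set m := ∫ ω, trunc c (X ω) ∂P with hm
  have hT1 : Integrable (fun ω => trunc c (X ω)) P := (memLp_trunc hX hc 2).integrable one_le_two
  have hTm : Measurable fun ω => trunc c (X ω) := (measurable_trunc c).comp hX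
  have h3 : Integrable (fun ω => |trunc c (X ω)| ^ 3) P :=
    Integrable.of_bound (hTm.norm.pow_const 3).aestronglyMeasurable (c ^ 3)
      (Filter.Eventually.of_forall fun ω => by
      rw [Real.norm_eq_abs, abs_pow, abs_abs]
      exact pow_le_pow_left₀ (abs_nonneg _) (abs_trunc_le hc _) 3)
  have hi : Integrable (fun ω => 3 * |m| * m * (m - trunc c (X ω))) P :=
    ((integrable_const m).sub hT1).const_mul _
  have h := integral_mono_of_nonneg (μ := P)
    (Filter.Eventually.of_forall fun ω => by positivity)
    ((h3.const_mul 2.5).add hi)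
    (Filter.Eventually.of_forall fun ω => abs_sub_cube_le m (trunc c (X ω)))
  simp only [Pi.add_apply] at h
  rw [integral_add (h3.const_mul 2.5) hi, integral_const_mul, integral_const_mul,
    integral_sub (integrable_const m) hT1, integral_cube_trunc hX, ← hm] at h
  simpa using h

lemma prob_tail_le (hX : Measurable X) (hX2 : MemLp X 2 P) (hc : 0 < c) :
    P.real {ω | c < |X ω|} ≤ (∫ ω in {ω | c < |X ω|}, X ω ^ 2 ∂P) / c ^ 2 := by
  have hs : MeasurableSet {ω | c < |X ω|} := measurableSet_lt measurable_const hX.norm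
  rw [le_div_iff₀ (by positivity)]
  have : ∫ ω in {ω | c < |X ω|}, c ^ 2 ∂P ≤ ∫ ω in {ω | c < |X ω|}, X ω ^ 2 ∂P := by
    refine setIntegral_mono_on (integrable_const _).integrableOn hX2.integrable_sq.integrableOn hs
      fun ω hω => ?_
    rw [← sq_abs (X ω)]
    exact pow_le_pow_left₀ hc.le (le_of_lt hω) 2
  rwa [setIntegral_const, smul_eq_mul] at this

lemma abs_real_sub_real_le {s t N : Set Ω} (h : ∀ ω ∉ N, ω ∈ s ↔ ω ∈ t) :
    |P.real s - P.real t| ≤ P.real N := by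
  have h1 : P.real s ≤ P.real t + P.real N :=
    (measureReal_mono fun ω hω => by
      by_cases hN : ω ∈ N
      · exact Or.inr hN
      · exact Or.inl ((h ω hN).1 hω)).trans (measureReal_union_le t N)
  have h2 : P.real t ≤ P.real s + P.real N :=
    (measureReal_mono fun ω hω => by
      by_cases hN : ω ∈ N
      · exact Or.inr hN
      · exact Or.inl ((h ω hN).2 hω)).trans (measureReal_union_le s N)
  rw [abs_le]; constructor <;> linarith

end Truncation

/-! ### Osipov's inequality -/

section

variable {Ω : Type u} [MeasurableSpace Ω] {n : ℕ} {P : Measure Ω} [IsProbabilityMeasure P]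
  {X : Fin n → Ω → ℝ}

lemma bddAbove_Delta (P : Measure Ω) [IsProbabilityMeasure P] (X : Fin n → Ω → ℝ) :
    BddAbove (Set.range fun x : ℝ =>
      |P.real {ω | ∑ k, X k ω < x * B P X} - stdNormalCDF x|) := by
  refine ⟨1, ?_⟩
  rintro _ ⟨x, rfl⟩
  exact abs_prob_sub_stdNormalCDF_le_one _ x

lemma Delta_le_one (P : Measure Ω) [IsProbabilityMeasure P] (X : Fin n → Ω → ℝ) :
    Delta P X ≤ 1 :=
  ciSup_le fun x => abs_prob_sub_stdNormalCDF_le_one _ x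

lemma Delta_nonneg (P : Measure Ω) (X : Fin n → Ω → ℝ) : 0 ≤ Delta P X :=
  Real.iSup_nonneg fun _ => abs_nonneg _

lemma L_nonneg (P : Measure Ω) (X : Fin n → Ω → ℝ) (ε : ℝ) : 0 ≤ L P X ε := by
  have : 0 ≤ B P X := Real.sqrt_nonneg _
  exact mul_nonneg (by positivity) (Finset.sum_nonneg fun k _ => integral_nonneg fun ω => by
    positivity)

lemma M_nonneg (P : Measure Ω) (X : Fin n → Ω → ℝ) (ε : ℝ) : 0 ≤ M P X ε := by
  have : 0 ≤ B P X := Real.sqrt_nonneg _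
  exact mul_nonneg (by positivity) (Finset.sum_nonneg fun k _ => integral_nonneg fun ω => by
    positivity)

omit [IsProbabilityMeasure P] in
lemma lyapunov_pos (h : Standing P X) (h3 : ∀ k, Integrable (fun ω => |X k ω| ^ 3) P) :
    0 < lyapunov P X := by
  have hB := B_pos h
  refine mul_pos (by positivity) ?_
  have hnn : ∀ k ∈ Finset.univ, 0 ≤ ∫ ω, |X k ω| ^ 3 ∂P := fun k _ =>
    integral_nonneg fun ω => by positivity
  refine lt_of_le_of_ne (Finset.sum_nonneg hnn) fun h0 => h.variance_pos.ne' ?_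
  refine Finset.sum_eq_zero fun k hk => ?_
  have hk0 := (Finset.sum_eq_zero_iff_of_nonneg hnn).1 h0.symm k hk
  have hae := (integral_eq_zero_iff_of_nonneg (fun ω => by positivity) (h3 k)).1 hk0
  refine integral_eq_zero_of_ae (hae.mono fun ω hω => ?_)
  have : X k ω = 0 := by simpa using hω
  simp [this]

/-- The Osipov inequality for a fixed truncation parameter, in the non-trivial range. -/
lemma Delta_le_of_L_lt {C₀ : ℝ} (hC : IsBerryEsseenConstant.{u} C₀) (h : Standing P X) {b : ℝ}
    (hb : 0 < b) (hL : L P X 1 < (1 - b ^ 2) / 2) :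
    Delta P X ≤ (1 + 4.25 * C₀ / b ^ 3 +
        1 / (Real.sqrt (2 * Real.pi) * b) * (1 + 2 * Real.exp (-1 / 2) / (1 + b))) *
      max (L P X 1) (M P X 1) := by
  have hBpos := B_pos h
  have hBsq := B_sq h
  have hLdef : L P X 1 = 1 / B P X ^ 2 *
      ∑ k, ∫ ω in {ω | B P X < |X k ω|}, X k ω ^ 2 ∂P := by simp only [L, one_mul]
  have hMdef : M P X 1 = 1 / B P X ^ 3 *
      ∑ k, ∫ ω in {ω | |X k ω| ≤ B P X}, |X k ω| ^ 3 ∂P := by simp only [M, one_mul]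
  set β := B P X with hβ
  set ℓ : Fin n → ℝ := fun k => ∫ ω in {ω | β < |X k ω|}, X k ω ^ 2 ∂P with hℓ
  set l := L P X 1 with hl
  have hl0 : 0 ≤ l := L_nonneg P X 1
  have hM0 : 0 ≤ M P X 1 := M_nonneg P X 1
  have hsumℓ : ∑ k, ℓ k = l * β ^ 2 := by
    rw [hLdef]; field_simp
  have hmeas := h.measurable
  have hX2 : ∀ k, MemLp (X k) 2 P := fun k =>
    (memLp_two_iff_integrable_sq (hmeas k).aestronglyMeasurable).2 (h.sq_integrable k)
  set m : Fin n → ℝ := fun k => ∫ ω, trunc β (X k ω) ∂P with hm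
  set Z : Fin n → Ω → ℝ := fun k ω => trunc β (X k ω) - m k with hZ
  have hZm : ∀ k, Measurable (Z k) := fun k =>
    ((measurable_trunc β).comp (hmeas k)).sub_const _
  have hZb : ∀ k ω, |Z k ω| ≤ β + |m k| := fun k ω =>
    (abs_sub _ _).trans (add_le_add_left (abs_trunc_le hBpos.le _) _)
  have hZvar : ∀ k, ∫ ω, Z k ω ^ 2 ∂P = ∫ ω, X k ω ^ 2 ∂P - ℓ k - m k ^ 2 := fun k => by
    rw [← integral_sq_trunc (hmeas k) (hX2 k) hBpos.le]
    exact integral_sq_centered_trunc (hmeas k) hBpos.le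
  have hmsq : ∀ k, m k ^ 2 ≤ ℓ k := fun k =>
    sq_integral_trunc_le (hmeas k) (hX2 k) (h.mean_zero k) hBpos
  have hℓ0 : ∀ k, 0 ≤ ℓ k := fun k => (sq_nonneg _).trans (hmsq k)
  -- Truncation loses ℓ_k of the k-th variance and recentring loses m_k² ≤ ℓ_k, whence the factor 2.
  have hlow : (1 - 2 * l) * β ^ 2 ≤ ∑ k, ∫ ω, Z k ω ^ 2 ∂P := by
    have : ∑ k, (∫ ω, X k ω ^ 2 ∂P - 2 * ℓ k) ≤ ∑ k, ∫ ω, Z k ω ^ 2 ∂P :=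
      Finset.sum_le_sum fun k _ => by rw [hZvar]; linarith [hmsq k]
    rw [Finset.sum_sub_distrib, ← Finset.mul_sum, hsumℓ, ← hBsq] at this
    linarith
  have hupp : ∑ k, ∫ ω, Z k ω ^ 2 ∂P ≤ β ^ 2 := by
    rw [hBsq]
    exact Finset.sum_le_sum fun k _ => by rw [hZvar]; linarith [hℓ0 k, sq_nonneg (m k)]
  have hblow : b ^ 2 * β ^ 2 < (1 - 2 * l) * β ^ 2 := by
    refine mul_lt_mul_of_pos_right (by linarith) (by positivity)
  have hZst : Standing P Z :=
    { measurable := hZm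
      indep := h.indep.comp (fun k y => trunc β y - m k) fun k =>
        (measurable_trunc β).sub_const _
      sq_integrable := fun k => ((memLp_trunc (hmeas k) hBpos.le 2).sub
        (memLp_const (m k))).integrable_sq
      mean_zero := fun k => by
        simp only [hZ]
        rw [integral_sub ((memLp_trunc (hmeas k) hBpos.le 2).integrable one_le_two)
          (integrable_const _)]
        simp [hm]
      variance_pos := lt_of_lt_of_le (lt_trans (by positivity) hblow) hlow }
  have hZ3 : ∀ k, Integrable (fun ω => |Z k ω| ^ 3) P := fun k =>
    Integrable.of_bound ((hZm k).norm.pow_const 3).aestronglyMeasurable ((β + |m k|) ^ 3)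
      (Filter.Eventually.of_forall fun ω => by
        rw [Real.norm_eq_abs, abs_pow, abs_abs]
        exact pow_le_pow_left₀ (abs_nonneg _) (hZb k ω) 3)
  set β' := B P Z with hβ'
  have hβ'pos : 0 < β' := B_pos hZst
  have hβ'sq : β' ^ 2 = ∑ k, ∫ ω, Z k ω ^ 2 ∂P := B_sq hZst
  have hβ'b : b * β ≤ β' := by
    refine le_of_sq_le_sq ?_ hβ'pos.le
    rw [mul_pow, hβ'sq]; linarith
  have hβ'le : β' ≤ β := le_of_sq_le_sq (by rw [hβ'sq]; exact hupp) hBpos.le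
  have hBE := hC n Ω P Z hZst hZ3
  -- A negative constant would contradict Δ ≥ 0 for the Z_k, whose Lyapunov fraction is positive.
  have hC0 : 0 ≤ C₀ := by
    by_contra hneg
    exact absurd ((Delta_nonneg P Z).trans hBE)
      (not_le.2 (mul_neg_of_neg_of_pos (not_le.1 hneg) (lyapunov_pos hZst hZ3)))
  have hlyap : lyapunov P Z ≤ 2.5 * M P X 1 / b ^ 3 := by
    have h1 : ∑ k, ∫ ω, |Z k ω| ^ 3 ∂P ≤
        2.5 * ∑ k, ∫ ω in {ω | |X k ω| ≤ β}, |X k ω| ^ 3 ∂P := by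
      rw [Finset.mul_sum]
      exact Finset.sum_le_sum fun k _ => integral_cube_centered_trunc_le (hmeas k) hBpos.le
    have h2 : ∑ k, ∫ ω in {ω | |X k ω| ≤ β}, |X k ω| ^ 3 ∂P = M P X 1 * β ^ 3 := by
      rw [hMdef]; field_simp
    rw [h2] at h1
    calc lyapunov P Z = (∑ k, ∫ ω, |Z k ω| ^ 3 ∂P) / β' ^ 3 := by rw [lyapunov]; ring
      _ ≤ (2.5 * (M P X 1 * β ^ 3)) / (b * β) ^ 3 := by gcongr
      _ = 2.5 * M P X 1 / b ^ 3 := by field_simp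
  have hsumm : |∑ k, m k| ≤ l * β := by
    calc |∑ k, m k| ≤ ∑ k, |m k| := Finset.abs_sum_le_sum_abs _ _
      _ ≤ ∑ k, ℓ k / β := Finset.sum_le_sum fun k _ =>
          abs_integral_trunc_le (hmeas k) (hX2 k) (h.mean_zero k) hBpos
      _ = l * β := by rw [← Finset.sum_div, hsumℓ]; field_simp
  set s := (Real.sqrt (2 * Real.pi))⁻¹ with hs
  have hs0 : 0 ≤ s := by positivity
  set r := β / β' with hr
  have hr1 : 1 ≤ r := (one_le_div hβ'pos).2 hβ'le
  have hrb : r ≤ 1 / b := by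
    rw [hr, div_le_div_iff₀ hβ'pos hb]; linarith
  have hr2 : r - 1 ≤ 2 * l / (b * (1 + b)) := by
    have e : r - 1 = (β ^ 2 - β' ^ 2) / (β' * (β + β')) := by
      rw [hr]; field_simp; ring
    rw [e]
    calc (β ^ 2 - β' ^ 2) / (β' * (β + β'))
        ≤ (2 * l * β ^ 2) / ((b * β) * (β + b * β)) := by
          gcongr
          rw [hβ'sq]; linarith
      _ = 2 * l / (b * (1 + b)) := by field_simp
  have hpoint : ∀ x : ℝ, |P.real {ω | ∑ k, X k ω < x * β} - stdNormalCDF x| ≤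
      l + C₀ * (2.5 * M P X 1 / b ^ 3) +
        (s * (l / b) + s * Real.exp (-1 / 2) * (2 * l / (b * (1 + b)))) := by
    intro x
    -- With this v, the events S_n < xβ and ∑ Z_k < vβ' coincide wherever no summand is truncated.
    set v := (x * β - ∑ k, m k) / β' with hv
    have hN : P.real (⋃ k, {ω | β < |X k ω|}) ≤ l := by
      calc P.real (⋃ k, {ω | β < |X k ω|}) ≤ ∑ k, P.real {ω | β < |X k ω|} :=
            measureReal_iUnion_fintype_le _
        _ ≤ ∑ k, ℓ k / β ^ 2 := Finset.sum_le_sum fun k _ =>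
            prob_tail_le (hmeas k) (hX2 k) hBpos
        _ = l := by rw [← Finset.sum_div, hsumℓ]; field_simp
    have h1 : |P.real {ω | ∑ k, X k ω < x * β} - P.real {ω | ∑ k, Z k ω < v * β'}| ≤ l := by
      refine (abs_real_sub_real_le fun ω hω => ?_).trans hN
      have hω' : ∀ k, trunc β (X k ω) = X k ω := fun k => by
        have : ω ∉ {ω | β < |X k ω|} := fun hk => hω (Set.mem_iUnion.2 ⟨k, hk⟩)
        exact if_pos (not_lt.1 this)
      simp only [Set.mem_ofPred_eq, hZ, hω', Finset.sum_sub_distrib]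
      rw [hv, div_mul_cancel₀ _ hβ'pos.ne', sub_lt_sub_iff_right]
    have h2 : |P.real {ω | ∑ k, Z k ω < v * β'} - stdNormalCDF v| ≤
        C₀ * (2.5 * M P X 1 / b ^ 3) :=
      (le_ciSup (bddAbove_Delta P Z) v).trans
        (hBE.trans (mul_le_mul_of_nonneg_left hlyap hC0))
    have h3 : |stdNormalCDF v - stdNormalCDF (x * r)| ≤ s * (l / b) := by
      refine (abs_stdNormalCDF_sub_le _ _).trans (mul_le_mul_of_nonneg_left ?_ hs0)
      have e : v - x * r = -((∑ k, m k) / β') := by rw [hv, hr]; ring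
      rw [e, abs_neg, abs_div, abs_of_pos hβ'pos]
      calc |∑ k, m k| / β' ≤ l * β / (b * β) := by gcongr
        _ = l / b := by field_simp
    have h4 : |stdNormalCDF (x * r) - stdNormalCDF x| ≤
        s * Real.exp (-1 / 2) * (2 * l / (b * (1 + b))) :=
      (abs_stdNormalCDF_mul_sub_le x hr1).trans
        (mul_le_mul_of_nonneg_left hr2 (by positivity))
    have t1 := abs_sub_le (P.real {ω | ∑ k, X k ω < x * β}) (P.real {ω | ∑ k, Z k ω < v * β'})
      (stdNormalCDF x)
    have t2 := abs_sub_le (P.real {ω | ∑ k, Z k ω < v * β'}) (stdNormalCDF v) (stdNormalCDF x)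
    have t3 := abs_sub_le (stdNormalCDF v) (stdNormalCDF (x * r)) (stdNormalCDF x)
    linarith
  refine (ciSup_le hpoint).trans ?_
  set A := max l (M P X 1) with hA
  have hlA : l ≤ A := le_max_left _ _
  have hMA : M P X 1 ≤ A := le_max_right _ _
  have hA0 : 0 ≤ A := hl0.trans hlA
  -- The factor 2.5 obtained here is relaxed to the 4.25 of the statement.
  calc l + C₀ * (2.5 * M P X 1 / b ^ 3) +
        (s * (l / b) + s * Real.exp (-1 / 2) * (2 * l / (b * (1 + b))))
      ≤ A + C₀ * (4.25 * A / b ^ 3) +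
        (s * (A / b) + s * Real.exp (-1 / 2) * (2 * A / (b * (1 + b)))) := by
        gcongr
        norm_num
    _ = _ := by
        rw [hs]; field_simp

lemma Delta_le_mul_max {C₀ : ℝ} (hC : IsBerryEsseenConstant.{u} C₀) (h : Standing P X) {b : ℝ}
    (hb : 0 < b) (hb1 : b < 1) :
    Delta P X ≤ max (2 / (1 - b ^ 2)) (1 + 4.25 * C₀ / b ^ 3 +
        1 / (Real.sqrt (2 * Real.pi) * b) * (1 + 2 * Real.exp (-1 / 2) / (1 + b))) *
      max (L P X 1) (M P X 1) := by
  have hA0 : 0 ≤ max (L P X 1) (M P X 1) := (L_nonneg P X 1).trans (le_max_left _ _)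
  have hb2 : 0 < 1 - b ^ 2 := by nlinarith
  rcases lt_or_ge (L P X 1) ((1 - b ^ 2) / 2) with hL | hL
  · exact (Delta_le_of_L_lt hC h hb hL).trans
      (mul_le_mul_of_nonneg_right (le_max_right _ _) hA0)
  · calc Delta P X ≤ 1 := Delta_le_one P X
      _ = 2 / (1 - b ^ 2) * ((1 - b ^ 2) / 2) := by field_simp
      _ ≤ 2 / (1 - b ^ 2) * max (L P X 1) (M P X 1) := by
          gcongr
          exact hL.trans (le_max_left _ _)
      _ ≤ _ := mul_le_mul_of_nonneg_right (le_max_left _ _) hA0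

lemma osipovConstant_nonneg (C₀ : ℝ) : 0 ≤ osipovConstant C₀ := by
  refine Real.sInf_nonneg ?_
  rintro y ⟨b, hb, hb1, rfl⟩
  have hb2 : 0 < 1 - b ^ 2 := by nlinarith
  exact le_max_of_le_left (by positivity)

lemma Delta_le_osipovConstant_mul_max {C₀ : ℝ} (hC : IsBerryEsseenConstant.{u} C₀)
    (h : Standing P X) : Delta P X ≤ osipovConstant C₀ * max (L P X 1) (M P X 1) := by
  have hA0 : 0 ≤ max (L P X 1) (M P X 1) := (L_nonneg P X 1).trans (le_max_left _ _)
  -- To pass to the infimum over b, divide by the maximum; if it vanishes, the single value b = 1/2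
  -- already gives Δ ≤ 0.
  rcases hA0.eq_or_lt with hA | hA
  · have := Delta_le_mul_max hC h (b := 1 / 2) (by norm_num) (by norm_num)
    rw [← hA, mul_zero] at this ⊢
    exact this
  · rw [← div_le_iff₀ hA]
    refine le_csInf ⟨_, 1 / 2, by norm_num, by norm_num, rfl⟩ ?_
    rintro y ⟨b, hb, hb1, rfl⟩
    rw [div_le_iff₀ hA]
    exact Delta_le_mul_max hC h hb hb1

end

end Osipov

theorem mainTheorem2 :
    Osipov.IsBerryEsseenConstant.{u} Osipov.berryEsseenValue ∧
    ∀ C₀ : ℝ, Osipov.IsBerryEsseenConstant.{u} C₀ →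
      ∀ (n : ℕ) (Ω : Type u) [MeasurableSpace Ω] (P : Measure Ω) [IsProbabilityMeasure P]
        (X : Fin n → Ω → ℝ), Osipov.Standing P X →
        Osipov.Delta P X ≤ Osipov.osipovConstant C₀ * (Osipov.L P X 1 + Osipov.M P X 1) ∧
        Osipov.Delta P X ≤ Osipov.osipovConstant C₀ * max (Osipov.L P X 1) (Osipov.M P X 1) := by
  refine ⟨Osipov.isBerryEsseenConstant_berryEsseenValue, fun C₀ hC n Ω _ P _ X h => ?_⟩
  have hmax := Osipov.Delta_le_osipovConstant_mul_max hC h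
  refine ⟨hmax.trans (mul_le_mul_of_nonneg_left ?_ (Osipov.osipovConstant_nonneg C₀)), hmax⟩
  exact max_le_add_of_nonneg (Osipov.L_nonneg P X 1) (Osipov.M_nonneg P X 1)
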